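/- \textbf{Corollary 1 (Variance reduction).} Let $K, M\ge 1$ and $d\ge 0$. For each sample size $n$ and each unit $i\in\{1,\dots,n\}$ let $Y_i(1),\dots,Y_i(K)\in\mathbb R$ be potential outcomes, $S_i\in\{1,\dots,M\}$ a stratum, $X_i\in\mathbb R^{d}$ covariates, $W_i\in\{1,\dots,K\}$ the treatment received and $Y_i=Y_i(W_i)$ the observed outcome (all of these may depend on $n$). Put $n(s)=\#\{i:S_i=s\}$, $n_w(s)=\#\{i: W_i=w,\ S_i=s\}$ and $\widehat\pi_w(s)=n_w(s)/n(s)$. Assume: (i) for each $n$ the vectors $(Y_i(1),\dots,Y_i(K),S_i,X_i)$, $i=1,\dots,n$, are i.i.d. with a law that does not depend on $n$, and $P(S_i=s)>0$ for every $s$; (ii) for each $n$, $\{Y_i(1),\dots,Y_i(K),X_i\}_{i=1}^n$ and $\{W_i\}_{i=1}^n$ are conditionally independent given $\{S_i\}_{i=1}^n$; (iii) $\widehat\pi_w(s)\to\pi_w(s)$ in probability as $n\to\infty$ for all $w,s$, where $\pi_w(s)\in(0,1)$ are the target assignment probabilities. For treatments $w,w'$ and $y\in\mathbb R$ let $\Delta_{w,w'}(y)=P(Y(w)\le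 y)-P(Y(w')\le y)$ be the distributional treatment effect (DTE), and let $\mu_w(y,s,x)=P(Y(w)\le y\mid S=s,X=x)$. The empirical (IPW) DTE estimator is $$\widehat\Delta^{emp}_{w,w'}(y)=\widehat F^{emp}_{w}(y)-\widehat F^{emp}_{w'}(y),\qquad \widehat F^{emp}_{w}(y)=\frac1n\sum_{i=1}^n\frac{1\{W_i=w\}\,1\{Y_i\le y\}}{\widehat\pi_w(S_i)},$$ and the regression-adjusted DTE estimator with known adjustment terms is $$\widetilde\Delta^{adj}_{w,w'}(y)=\widetilde F^{adj}_{w}(y)-\widetilde F^{adj}_{w'}(y),\qquad \widetilde F^{adj}_{w}(y)=\frac1n\sum_{i=1}^n\Big[\frac{1\{W_i=w\}\,(1\{Y_i\le y\}-\mu_w(y,S_i,X_i))}{\widehat\pi_w(S_i)}+\mu_w(y,S_i,X_i)\Big],$$ where a summand fraction with $\widehat\pi_w(S_i)=0$ (hence $W_i\neq w$) is read as $0$. Then for all $w,w'$ and every $y$ both estimators are asymptotically normal and the adjusted one has the smaller asymptotic variance: there are $V^{adj},V^{emp}\ge 0$ such that, as $n\to\infty$, $$\sqrt n\big(\widetilde\Delta^{adj}_{w,w'}(y)-\Delta_{w,w'}(y)\big)\xrightarrow{d}N(0,V^{adj}),\qquad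 \sqrt n\big(\widehat\Delta^{emp}_{w,w'}(y)-\Delta_{w,w'}(y)\big)\xrightarrow{d}N(0,V^{emp}),$$ and $V^{adj}\le V^{emp}$ (where $N(0,0)$ is the point mass at $0$). -/

import Mathlib

open MeasureTheory ProbabilityTheory Filter Topology
open scoped NNReal ENNReal

namespace CAR

/-- The characteristics `(Y(1), …, Y(K), S, X)` of one unit: potential outcomes under the `K`
treatments, stratum (one of `M`), and extra covariates in `ℝ^d`. -/
abbrev UnitData (K M d : ℕ) : Type := (Fin K → ℝ) × Fin M × (Fin d → ℝ)

/-- The raw random variables of a sequence of experiments, one for each sample size `n`: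
`pot n i w` is the potential outcome `Y_i(w)`, `strat n i` the stratum `S_i`, `cov n i` the
covariate vector `X_i` and `treat n i` the treatment `W_i` of unit `i` in the sample of size `n`.
Everything may depend on `n`, as the assignments do in stratified block randomization. -/
structure Experiment (Ω : Type*) (K M d : ℕ) where
  pot : (n : ℕ) → Fin n → Fin K → Ω → ℝ
  strat : (n : ℕ) → Fin n → Ω → Fin M
  cov : (n : ℕ) → Fin n → Ω → (Fin d → ℝ)
  treat : (n : ℕ) → Fin n → Ω → Fin K

noncomputable section

variable {Ω : Type*} {K M d : ℕ}

namespace Experiment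

/-- `(Y_i(1), …, Y_i(K), S_i, X_i)`. -/
def unit (E : Experiment Ω K M d) (n : ℕ) (i : Fin n) (ω : Ω) : UnitData K M d :=
  (fun w => E.pot n i w ω, E.strat n i ω, E.cov n i ω)

/-- The observed outcome `Y_i = Y_i(W_i)`. -/
def obs (E : Experiment Ω K M d) (n : ℕ) (i : Fin n) (ω : Ω) : ℝ :=
  E.pot n i (E.treat n i ω) ω

/-- `n(s)`, the number of units in stratum `s`. -/
def nStrat (E : Experiment Ω K M d) (n : ℕ) (s : Fin M) (ω : Ω) : ℕ :=
  (Finset.univ.filter fun i : Fin n => E.strat n i ω = s).card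

/-- `n_w(s)`, the number of units in stratum `s` that receive treatment `w`. -/
def nTreat (E : Experiment Ω K M d) (n : ℕ) (w : Fin K) (s : Fin M) (ω : Ω) : ℕ :=
  (Finset.univ.filter fun i : Fin n => E.treat n i ω = w ∧ E.strat n i ω = s).card

/-- The empirical assignment probability `π̂_w(s) = n_w(s) / n(s)` (`0` on an empty stratum). -/
def piHat (E : Experiment Ω K M d) (n : ℕ) (w : Fin K) (s : Fin M) (ω : Ω) : ℝ :=
  (E.nTreat n w s ω : ℝ) / (E.nStrat n s ω : ℝ)

/-- The regression-adjusted (augmented inverse propensity weighted) estimator of the distribution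
function `F_{Y(w)}(y)`, with `m s x` in the place of the adjustment term `μ_w(y, s, x)`.
If `π̂_w(S_i) = 0`, then `W_i ≠ w`, and the fraction is read as `0`. -/
def cdfAIPW (E : Experiment Ω K M d) (m : Fin M → (Fin d → ℝ) → ℝ) (n : ℕ) (w : Fin K) (y : ℝ)
    (ω : Ω) : ℝ :=
  (1 / (n : ℝ)) * ∑ i : Fin n,
    ((if E.treat n i ω = w then (1 : ℝ) else 0)
        * ((if E.obs n i ω ≤ y then (1 : ℝ) else 0) - m (E.strat n i ω) (E.cov n i ω))
        / E.piHat n w (E.strat n i ω) ω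
      + m (E.strat n i ω) (E.cov n i ω))

/-- The empirical (inverse propensity weighted) estimator of `F_{Y(w)}(y)`. -/
def cdfEmp (E : Experiment Ω K M d) (n : ℕ) (w : Fin K) (y : ℝ) (ω : Ω) : ℝ :=
  (1 / (n : ℝ)) * ∑ i : Fin n,
    (if E.treat n i ω = w then (1 : ℝ) else 0) * (if E.obs n i ω ≤ y then (1 : ℝ) else 0)
      / E.piHat n w (E.strat n i ω) ω

end Experiment

/-- `F_{Y(w)}(y)`, where `Q` is the law of the characteristics of a unit. -/
def popCDF (Q : Measure (UnitData K M d)) (w : Fin K) (y : ℝ) : ℝ :=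
  Q.real {u | u.1 w ≤ y}

/-- The distributional treatment effect `F_{Y(w)}(y) - F_{Y(w')}(y)`. -/
def dte (Q : Measure (UnitData K M d)) (w w' : Fin K) (y : ℝ) : ℝ :=
  popCDF Q w y - popCDF Q w' y

/-- The conditional distribution function `μ_w(y, s, x) = P(Y(w) ≤ y | S = s, X = x)`. -/
def condCDF (Q : Measure (UnitData K M d)) [IsFiniteMeasure Q] (w : Fin K) (y : ℝ)
    (s : Fin M) (x : Fin d → ℝ) : ℝ :=
  (condDistrib (fun u : UnitData K M d => u.1 w) (fun u : UnitData K M d => u.2) Q (s, x)).real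
    (Set.Iic y)

namespace Experiment

/-- The empirical estimator of the distributional treatment effect. -/
def dteEmp (E : Experiment Ω K M d) (w w' : Fin K) (y : ℝ) (n : ℕ) (ω : Ω) : ℝ :=
  E.cdfEmp n w y ω - E.cdfEmp n w' y ω

/-- The regression-adjusted estimator of the distributional treatment effect with known
adjustment terms `μ_w(y, ·, ·)` and `μ_{w'}(y, ·, ·)`. -/
def dteAdj (E : Experiment Ω K M d) (Q : Measure (UnitData K M d)) [IsFiniteMeasure Q]
    (w w' : Fin K) (y : ℝ) (n : ℕ) (ω : Ω) : ℝ :=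
  E.cdfAIPW (condCDF Q w y) n w y ω - E.cdfAIPW (condCDF Q w' y) n w' y ω

/-- Covariate-adaptive randomization with target assignment probabilities `π w s`, for units
whose characteristics have law `Q`. -/
structure IsCAR [MeasurableSpace Ω] (E : Experiment Ω K M d) (P : Measure Ω)
    (Q : Measure (UnitData K M d)) (π : Fin K → Fin M → ℝ) : Prop where
  measurable_unit : ∀ n i, Measurable (E.unit n i)
  measurable_treat : ∀ n i, Measurable (E.treat n i)
  /-- `p(s) > 0`: no stratum is empty in the population. -/
  strat_pos : ∀ s : Fin M, 0 < Q {u | u.2.1 = s}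
  target_mem : ∀ w s, π w s ∈ Set.Ioo (0 : ℝ) 1
  /-- The units of each sample are independent … -/
  indep : ∀ n, iIndepFun (E.unit n) P
  /-- … and identically distributed, with a law that does not depend on the sample size. -/
  law : ∀ n i, HasLaw (E.unit n i) Q P
  /-- Potential outcomes and covariates of the sample are independent of the assignments given
  the strata of the sample. The strata take finitely many values, so this is independence under
  the elementary conditional probability given each value (of positive probability). -/
  condIndep : ∀ (n : ℕ) (s : Fin n → Fin M),
    IndepFun (fun ω (i : Fin n) => ((fun w => E.pot n i w ω), E.cov n i ω))
      (fun ω (i : Fin n) => E.treat n i ω)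
      (P[|{ω | ∀ i, E.strat n i ω = s i}])
  /-- `π̂_w(s) → π_w(s)` in probability. -/
  tendsto_piHat : ∀ w s,
    TendstoInMeasure P (fun n => E.piHat n w s) atTop (fun _ => π w s)

end Experiment

/-- `V` is the asymptotic variance of the estimators `T n` of `θ`:
`√n (T n - θ)` converges in distribution to `N(0, V)`. -/
def HasAsymptoticVariance [MeasurableSpace Ω] (P : Measure Ω) [IsProbabilityMeasure P]
    (T : ℕ → Ω → ℝ) (θ : ℝ) (V : ℝ≥0) : Prop :=
  TendstoInDistribution (fun (n : ℕ) ω => Real.sqrt n * (T n ω - θ)) atTop (id : ℝ → ℝ)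
    (fun _ => P) (gaussianReal 0 V)

end

end CAR

/-!
Conditionally on the strata and the assignments the units are independent, and the law of a unit
depends only on its stratum. Outside an event of vanishing probability, `√n (estimator - DTE)` is a
normalized sum of bounded scores that are centered within strata and evaluated at the empirical
assignment probabilities, plus an i.i.d. sum of a centered function of the stratum. The conditional
characteristic function of the first sum converges in probability to a constant, so the two sums
are asymptotically independent and Gaussian.

Replacing the true conditional distribution functions by other adjustment terms adds to the score a
function of the stratum, the covariates and the treatment. It is orthogonal to the score, because
`1{Y(w) ≤ y} - μ_w(y, S, X)` has conditional mean zero given `(S, X)` and because the added terms,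
weighted by the assignment probabilities, sum to zero over the treatments. Hence the asymptotic
variance can only grow; the empirical estimator is the case of zero adjustment.
-/

namespace CAR

noncomputable section

/-! ### Events of high probability -/

/-- The filter of families of events whose probability tends to `1` along `l`. Convergence in
probability to a constant is convergence along this filter, so that finite intersections of events
and continuous maps are handled by the general theory of filters. -/
def whp {ι Ω : Type*} [MeasurableSpace Ω] (P : Measure Ω) (l : Filter ι) : Filter (ι × Ω) where
  sets := {A | Tendsto (fun n => P {ω | (n, ω) ∉ A}) l (𝓝 0)}
  univ_sets := by simpa using tendsto_const_nhds
  sets_of_superset hA hAB := tendsto_of_tendsto_of_tendsto_of_le_of_le tendsto_const_nhds hA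
    (fun _ => zero_le) fun _ => measure_mono fun _ hω h => hω (hAB h)
  inter_sets {A B} hA hB := by
    refine tendsto_of_tendsto_of_tendsto_of_le_of_le tendsto_const_nhds
      (by simpa only [add_zero] using Tendsto.add hA hB) (fun _ => zero_le) fun n => ?_
    exact (measure_mono fun ω hω => not_and_or.1 hω).trans (measure_union_le _ _)

section whp

variable {ι Ω : Type*} [MeasurableSpace Ω] {P : Measure Ω} {l : Filter ι}

lemma eventually_whp {p : ι × Ω → Prop} :
    (∀ᶠ x in whp P l, p x) ↔ Tendsto (fun n => P {ω | ¬p (n, ω)}) l (𝓝 0) :=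
  Iff.rfl

lemma tendsto_fst_whp : Tendsto Prod.fst (whp P l) l := fun s hs =>
  (tendsto_congr' (by filter_upwards [hs] with n hn; simp [hn])).2 tendsto_const_nhds

instance [IsProbabilityMeasure P] [l.NeBot] : (whp P l).NeBot where
  ne' h := by
    have hfalse := eventually_false_iff_eq_bot.2 h
    rw [eventually_whp] at hfalse
    simp at hfalse

lemma tendstoInMeasure_const_iff_tendsto_whp {β : Type*} [PseudoMetricSpace β] {f : ι → Ω → β}
    {b : β} :
    TendstoInMeasure P f l (fun _ => b) ↔ Tendsto (fun x => f x.1 x.2) (whp P l) (𝓝 b) := by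
  simp only [tendstoInMeasure_iff_dist, Metric.tendsto_nhds, eventually_whp, not_lt, gt_iff_lt]

lemma tendsto_integral_of_tendsto_whp_zero [IsProbabilityMeasure P] {f : ι → Ω → ℂ} {C : ℝ}
    (hm : ∀ n, Measurable (f n)) (hC : ∀ n ω, ‖f n ω‖ ≤ C)
    (hf : Tendsto (fun x => f x.1 x.2) (whp P l) (𝓝 0)) :
    Tendsto (fun n => ∫ ω, f n ω ∂P) l (𝓝 0) := by
  have hbad : ∀ n (ε : ℝ), MeasurableSet {ω | ε ≤ ‖f n ω‖} := fun n ε =>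
    measurableSet_le measurable_const (hm n).norm
  have hle : ∀ ε > 0, ∀ n, ‖∫ ω, f n ω ∂P‖ ≤ ε + C * P.real {ω | ε ≤ ‖f n ω‖} := fun ε hε n => by
    calc ‖∫ ω, f n ω ∂P‖
        ≤ ∫ ω, (ε + {ω | ε ≤ ‖f n ω‖}.indicator (fun _ => C) ω) ∂P := by
          refine norm_integral_le_of_norm_le
            ((integrable_const _).add ((integrable_const _).indicator (hbad n ε)))
            (ae_of_all _ fun ω => ?_)
          by_cases h : ε ≤ ‖f n ω‖
          · simpa [h] using (hC n ω).trans (le_add_of_nonneg_left hε.le)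
          · simpa [h] using (not_le.1 h).le
      _ = ε + C * P.real {ω | ε ≤ ‖f n ω‖} := by
          rw [integral_add (integrable_const _) ((integrable_const _).indicator (hbad n ε)),
            integral_indicator_const _ (hbad n ε)]
          simp [mul_comm]
  rw [Metric.tendsto_nhds]
  intro ε hε
  have hprob : Tendsto (fun n => P.real {ω | ε / 2 ≤ ‖f n ω‖}) l (𝓝 0) := by
    have := Metric.tendsto_nhds.1 hf (ε / 2) (half_pos hε)
    simp only [dist_zero_right, eventually_whp, not_lt] at this
    exact (ENNReal.tendsto_toReal ENNReal.zero_ne_top).comp this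
  have hlim : Tendsto (fun n => ε / 2 + C * P.real {ω | ε / 2 ≤ ‖f n ω‖}) l (𝓝 (ε / 2)) := by
    simpa using (hprob.const_mul C).const_add (ε / 2)
  filter_upwards [hlim.eventually_lt_const (half_lt_self hε)] with n hn
  simpa only [dist_zero_right] using (hle _ (half_pos hε) n).trans_lt hn

lemma tendsto_integral_mul_of_tendsto_whp [IsProbabilityMeasure P] {f g : ι → Ω → ℂ} {C D : ℝ}
    {a b : ℂ} (hfm : ∀ n, Measurable (f n)) (hgm : ∀ n, Measurable (g n))
    (hf : ∀ n ω, ‖f n ω‖ ≤ C) (hg : ∀ n ω, ‖g n ω‖ ≤ D)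
    (ha : Tendsto (fun n => ∫ ω, f n ω ∂P) l (𝓝 a))
    (hb : Tendsto (fun x => g x.1 x.2) (whp P l) (𝓝 b)) :
    Tendsto (fun n => ∫ ω, f n ω * g n ω ∂P) l (𝓝 (a * b)) := by
  have hbd (n : ι) (ω : Ω) : ‖f n ω * (g n ω - b)‖ ≤ C * (D + ‖b‖) := by
    rw [norm_mul]
    gcongr
    · exact (norm_nonneg _).trans (hf n ω)
    · exact hf n ω
    · exact (norm_sub_le _ _).trans (add_le_add_left (hg n ω) _)
  have hm (n : ι) : Measurable fun ω => f n ω * (g n ω - b) :=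
    (hfm n).mul ((hgm n).sub_const b)
  have hwhp : Tendsto (fun x : ι × Ω => f x.1 x.2 * (g x.1 x.2 - b)) (whp P l) (𝓝 0) := by
    refine squeeze_zero_norm (a := fun x => C * ‖g x.1 x.2 - b‖) (fun x => ?_) ?_
    · rw [norm_mul]
      gcongr
      exact hf _ _
    · simpa using ((hb.sub_const b).norm.const_mul C)
  have hlim := (tendsto_integral_of_tendsto_whp_zero hm hbd hwhp).add (ha.mul_const b)
  rw [zero_add] at hlim
  refine hlim.congr fun n => ?_
  rw [← integral_mul_const, ← integral_add
    (Integrable.of_bound (hm n).aestronglyMeasurable _ (ae_of_all _ (hbd n)))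
    ((Integrable.of_bound (hfm n).aestronglyMeasurable _ (ae_of_all _ (hf n))).mul_const b)]
  simp only [mul_sub, sub_add_cancel]

lemma tendsto_whp_of_tendsto_variance [IsFiniteMeasure P] {f : ι → Ω → ℝ} {m : ℝ}
    (hf : ∀ n, MemLp (f n) 2 P) (hm : ∀ᶠ n in l, P[f n] = m)
    (hvar : Tendsto (fun n => variance (f n) P) l (𝓝 0)) :
    Tendsto (fun x => f x.1 x.2) (whp P l) (𝓝 m) := by
  rw [← tendstoInMeasure_const_iff_tendsto_whp, tendstoInMeasure_iff_dist]
  intro ε hε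
  refine tendsto_of_tendsto_of_tendsto_of_le_of_le' tendsto_const_nhds
    (by simpa using ENNReal.tendsto_ofReal (hvar.div_const (ε ^ 2)))
    (Eventually.of_forall fun _ => zero_le) ?_
  filter_upwards [hm] with n hn
  simpa only [hn, Real.dist_eq] using meas_ge_le_variance_div_sq (hf n) hε

lemma tendsto_whp_average [IsProbabilityMeasure P] {X : (n : ℕ) → Fin n → Ω → ℝ} {m V : ℝ}
    (hX : ∀ n i, MemLp (X n i) 2 P)
    (hindep : ∀ n, Pairwise fun i j => IndepFun (X n i) (X n j) P) (hm : ∀ n i, P[X n i] = m)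
    (hV : ∀ n i, variance (X n i) P ≤ V) :
    Tendsto (fun x : ℕ × Ω => (∑ i, X x.1 i x.2) / x.1) (whp P atTop) (𝓝 m) := by
  have hsum : ∀ n, MemLp (fun ω => ∑ i, X n i ω) 2 P := fun n =>
    memLp_finsetSum _ fun i _ => hX n i
  refine tendsto_whp_of_tendsto_variance (f := fun n ω => (∑ i, X n i ω) / n)
    (fun n => by simpa only [div_eq_inv_mul] using (hsum n).const_mul _) ?_ ?_
  · filter_upwards [eventually_ne_atTop 0] with n hn
    have : (n : ℝ) ≠ 0 := mod_cast hn
    rw [integral_div, integral_finsetSum _ fun i _ => (hX n i).integrable one_le_two]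
    simp [hm, this]
  · refine squeeze_zero' (Eventually.of_forall fun _ => variance_nonneg _ _) ?_
      (tendsto_const_div_atTop_nhds_zero_nat V)
    filter_upwards [eventually_gt_atTop 0] with n hn
    have : (0 : ℝ) < n := mod_cast hn
    calc variance (fun ω => (∑ i, X n i ω) / n) P
        = (∑ i, variance (X n i) P) / n ^ 2 := by
          simp only [div_eq_inv_mul]
          rw [variance_const_mul, ← IndepFun.variance_sum (fun i _ => hX n i)
            fun i _ j _ hij => hindep n hij, inv_pow]
          congr 2
          ext ω
          simp
      _ ≤ (n * V) / n ^ 2 := by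
          gcongr
          simpa using Finset.sum_le_card_nsmul Finset.univ _ V fun i _ => hV n i
      _ = V / n := by field_simp

end whp

/-! ### Second-order expansion of characteristic functions -/

section CharFun

variable {ι : Type*} {l : Filter ι} {N : ι → ℕ}

lemma tendsto_pow_of_tendsto_mul_sub_one {z : ι → ℂ} {k : ι → ℕ} {L : ℂ} {q : ℝ}
    (hN : Tendsto N l atTop) (hz : Tendsto (fun j => (N j : ℂ) * (z j - 1)) l (𝓝 L))
    (hk : Tendsto (fun j => (k j : ℝ) / N j) l (𝓝 q)) :
    Tendsto (fun j => z j ^ k j) l (𝓝 (Complex.exp (q * L))) := by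
  have hN0 : ∀ᶠ j in l, (N j : ℂ) ≠ 0 :=
    (hN.eventually_ne_atTop 0).mono fun j hj => Nat.cast_ne_zero.2 hj
  have hz1 : Tendsto z l (𝓝 1) := by
    have hmul := ((tendsto_inv_atTop_nhds_zero_nat (𝕜 := ℂ)).comp hN).mul hz
    rw [zero_mul] at hmul
    refine tendsto_sub_nhds_zero_iff.1 (hmul.congr' ?_)
    filter_upwards [hN0] with j hj
    simp [hj]
  have hlog : Tendsto (fun j => (N j : ℂ) * Complex.log (z j)) l (𝓝 L) := by
    have hderiv : (fun w : ℂ => Complex.log w - (w - 1)) =o[𝓝 1] fun w => w - 1 := by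
      simpa using (Complex.hasDerivAt_log (z := 1) (by simp)).isLittleO
    have hrem : (fun j => (N j : ℂ) * (Complex.log (z j) - (z j - 1))) =o[l] fun _ => (1 : ℂ) :=
      ((Asymptotics.isBigO_refl _ _).mul_isLittleO (hderiv.comp_tendsto hz1)).trans_isBigO
        (hz.isBigO_one ℂ)
    simpa [← mul_add] using ((Asymptotics.isLittleO_one_iff ℂ).1 hrem).add hz
  have hk' : Tendsto (fun j => (k j : ℂ) / N j) l (𝓝 q) := by
    simpa [Function.comp_def] using (Complex.continuous_ofReal.tendsto q).comp hk
  refine ((Complex.continuous_exp.tendsto _).comp (hk'.mul hlog)).congr' ?_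
  filter_upwards [hN0, hz1.eventually_ne one_ne_zero] with j hNj hzj
  have hcancel : (k j : ℂ) / N j * (N j * Complex.log (z j)) = k j * Complex.log (z j) := by
    field_simp
  rw [Function.comp_apply, hcancel, Complex.exp_nat_mul, Complex.exp_log hzj]

lemma norm_exp_mul_I_sub_one_sub_le (x : ℝ) :
    ‖Complex.exp (x * Complex.I) - 1 - x * Complex.I‖ ≤ 3 * x ^ 2 := by
  have hx : ‖(x : ℂ) * Complex.I‖ = |x| := by simp
  rw [← sq_abs x]
  rcases le_total |x| 1 with h | h
  · have := Complex.norm_exp_sub_one_sub_id_le (x := x * Complex.I) (by rwa [hx])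
    rw [hx] at this
    nlinarith [sq_nonneg |x|]
  · calc ‖Complex.exp (x * Complex.I) - 1 - x * Complex.I‖
        ≤ ‖Complex.exp (x * Complex.I)‖ + ‖(1 : ℂ)‖ + ‖(x : ℂ) * Complex.I‖ :=
          (norm_sub_le _ _).trans (add_le_add_left (norm_sub_le _ _) _)
      _ = 1 + 1 + |x| := by rw [Complex.norm_exp_ofReal_mul_I, norm_one, hx]
      _ ≤ 3 * |x| ^ 2 := by nlinarith

lemma natCast_mul_div_sqrt_sq {n : ℕ} (hn : n ≠ 0) (x : ℝ) : n * (x / √n) ^ 2 = x ^ 2 := by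
  have : (n : ℝ) ≠ 0 := Nat.cast_ne_zero.2 hn
  rw [div_pow, Real.sq_sqrt n.cast_nonneg, mul_div_cancel₀ _ this]

lemma tendsto_natCast_mul_exp_sub_one_sub {x : ι → ℝ} {x₀ : ℝ}
    (hN : Tendsto N l atTop) (hx : Tendsto x l (𝓝 x₀)) :
    Tendsto (fun j => (N j : ℂ) * (Complex.exp ((x j / √(N j) : ℝ) * Complex.I) - 1
      - (x j / √(N j) : ℝ) * Complex.I)) l (𝓝 ((-(x₀ ^ 2) / 2 : ℝ) : ℂ)) := by
  set y := fun j => x j / √(N j) with hy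
  have hy0 : Tendsto (fun j => (y j : ℂ) * Complex.I) l (𝓝 0) := by
    have h : Tendsto y l (𝓝 0) :=
      hx.div_atTop (Real.tendsto_sqrt_atTop.comp (tendsto_natCast_atTop_atTop.comp hN))
    simpa using ((Complex.continuous_ofReal.tendsto 0).comp h).mul_const Complex.I
  have hsq : (fun j => (N j : ℂ) * ((y j : ℂ) * Complex.I) ^ 2) =ᶠ[l]
      fun j => ((-(x j ^ 2) : ℝ) : ℂ) := by
    filter_upwards [hN.eventually_ne_atTop 0] with j hj
    rw [mul_pow, Complex.I_sq, ← natCast_mul_div_sqrt_sq hj (x j)]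
    push_cast [hy]
    ring
  have hlim : Tendsto (fun j => ((-(x j ^ 2) : ℝ) : ℂ)) l (𝓝 ((-(x₀ ^ 2) : ℝ) : ℂ)) :=
    (Complex.continuous_ofReal.tendsto _).comp (hx.pow 2).neg
  have htaylor : (fun z : ℂ => Complex.exp z - ∑ i ∈ Finset.range 3, z ^ i / i.factorial)
      =o[𝓝 0] fun z => z ^ 2 := Complex.exp_sub_sum_range_succ_isLittleO_pow 2
  have hrem := (Asymptotics.isLittleO_one_iff ℂ).1 <|
    ((Asymptotics.isBigO_refl (fun j => (N j : ℂ)) l).mul_isLittleO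
      (htaylor.comp_tendsto hy0)).trans_isBigO ((hlim.congr' hsq.symm).isBigO_one ℂ)
  convert hrem.add ((hlim.congr' hsq.symm).div_const 2) using 2 with j
  · simp [Finset.sum_range_succ, hy]
    ring
  · push_cast
    ring

lemma tendsto_natCast_mul_integral_exp_sub_one [l.IsCountablyGenerated] {α : Type*}
    [MeasurableSpace α] (μ : Measure α) [IsProbabilityMeasure μ] {a : ι → α → ℝ} {a₀ : α → ℝ}
    {C : ℝ} (hN : Tendsto N l atTop) (ha : ∀ j, Measurable (a j))
    (hC : ∀ᶠ j in l, ∀ u, |a j u| ≤ C) (hlim : ∀ u, Tendsto (fun j => a j u) l (𝓝 (a₀ u)))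
    (hmean : ∀ j, ∫ u, a j u ∂μ = 0) :
    Tendsto (fun j => (N j : ℂ) * (∫ u, Complex.exp ((a j u / √(N j) : ℝ) * Complex.I) ∂μ - 1)) l
      (𝓝 ((-(∫ u, a₀ u ^ 2 ∂μ) / 2 : ℝ) : ℂ)) := by
  have hbound : ∀ᶠ j in l, ∀ᵐ u ∂μ, ‖(N j : ℂ)
      * (Complex.exp ((a j u / √(N j) : ℝ) * Complex.I) - 1 - (a j u / √(N j) : ℝ) * Complex.I)‖
        ≤ 3 * C ^ 2 := by
    filter_upwards [hC, hN.eventually_ne_atTop 0] with j hj hNj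
    refine ae_of_all _ fun u => ?_
    rw [norm_mul, Complex.norm_natCast]
    calc (N j : ℝ) * _ ≤ N j * (3 * (a j u / √(N j)) ^ 2) := by
          gcongr; exact norm_exp_mul_I_sub_one_sub_le _
      _ = 3 * a j u ^ 2 := by rw [← natCast_mul_div_sqrt_sq hNj (a j u)]; ring
      _ ≤ 3 * C ^ 2 := by gcongr 3 * ?_; exact sq_le_sq.2 ((hj u).trans (le_abs_self C))
  have hdom := tendsto_integral_filter_of_dominated_convergence (fun _ => 3 * C ^ 2)
    (Eventually.of_forall fun j => Measurable.aestronglyMeasurable (by have := ha j; fun_prop))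
    hbound (integrable_const _)
    (ae_of_all _ fun u => tendsto_natCast_mul_exp_sub_one_sub hN (hlim u))
  have hlimit : ∫ u, ((-(a₀ u ^ 2) / 2 : ℝ) : ℂ) ∂μ = ((-(∫ u, a₀ u ^ 2 ∂μ) / 2 : ℝ) : ℂ) := by
    rw [integral_complex_ofReal, integral_div, integral_neg]
  rw [hlimit] at hdom
  refine hdom.congr' ?_
  filter_upwards [hC] with j hj
  have hlin : Integrable (fun u => ((a j u / √(N j) : ℝ) : ℂ) * Complex.I) μ :=
    ((Integrable.of_bound (ha j).aestronglyMeasurable C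
      (ae_of_all _ hj)).div_const _).ofReal.mul_const Complex.I
  have hexp : Integrable (fun u => Complex.exp ((a j u / √(N j) : ℝ) * Complex.I)) μ :=
    Integrable.of_bound (C := 1) (Measurable.aestronglyMeasurable (by have := ha j; fun_prop))
      (ae_of_all _ fun u => (Complex.norm_exp_ofReal_mul_I _).le)
  rw [integral_const_mul, integral_sub (hexp.sub' (integrable_const _)) hlin,
    integral_sub hexp (integrable_const _), integral_mul_const, integral_complex_ofReal,
    integral_div, hmean j]
  simp

end CharFun

/-! ### Bounded measurable functions -/

/-- Bounded measurable real functions: the class in which all outcomes, adjustment terms and their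
products live, closed under pointwise operations and integrable for every finite measure. -/
structure BddMeasurable {α : Type*} [MeasurableSpace α] (f : α → ℝ) : Prop where
  measurable : Measurable f
  bdd : ∃ C, ∀ x, |f x| ≤ C

namespace BddMeasurable

variable {α β : Type*} [MeasurableSpace α] [MeasurableSpace β] {f g : α → ℝ}

lemma const (c : ℝ) : BddMeasurable fun _ : α => c :=
  ⟨measurable_const, |c|, fun _ => le_rfl⟩

lemma of_finite [Finite α] [MeasurableSingletonClass α] (f : α → ℝ) : BddMeasurable f := by
  refine ⟨measurable_of_finite f, ?_⟩
  obtain ⟨C, hC⟩ := (Set.finite_range fun x => |f x|).bddAbove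
  exact ⟨C, fun x => hC ⟨x, rfl⟩⟩

lemma comp (hf : BddMeasurable f) {h : β → α} (hh : Measurable h) :
    BddMeasurable fun x => f (h x) :=
  ⟨hf.measurable.comp hh, hf.bdd.imp fun _ hC x => hC (h x)⟩

lemma mul (hf : BddMeasurable f) (hg : BddMeasurable g) : BddMeasurable fun x => f x * g x := by
  obtain ⟨C, hC⟩ := hf.bdd
  obtain ⟨D, hD⟩ := hg.bdd
  refine ⟨hf.measurable.mul hg.measurable, C * D, fun x => ?_⟩
  rw [abs_mul]
  exact mul_le_mul (hC x) (hD x) (abs_nonneg _) ((abs_nonneg _).trans (hC x))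

lemma add (hf : BddMeasurable f) (hg : BddMeasurable g) : BddMeasurable fun x => f x + g x := by
  obtain ⟨C, hC⟩ := hf.bdd
  obtain ⟨D, hD⟩ := hg.bdd
  exact ⟨hf.measurable.add hg.measurable, C + D,
    fun x => (abs_add_le _ _).trans (add_le_add (hC x) (hD x))⟩

lemma sub (hf : BddMeasurable f) (hg : BddMeasurable g) : BddMeasurable fun x => f x - g x := by
  simpa only [sub_eq_add_neg, neg_one_mul] using hf.add ((const (-1)).mul hg)

lemma pow (hf : BddMeasurable f) (n : ℕ) : BddMeasurable fun x => f x ^ n := by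
  obtain ⟨C, hC⟩ := hf.bdd
  exact ⟨hf.measurable.pow_const n, C ^ n, fun x => by
    rw [abs_pow]; exact pow_le_pow_left₀ (abs_nonneg _) (hC x) n⟩

lemma sum {ι : Type*} {s : Finset ι} {F : ι → α → ℝ} (hF : ∀ i ∈ s, BddMeasurable (F i)) :
    BddMeasurable fun x => ∑ i ∈ s, F i x := by
  choose! C hC using fun i hi => (hF i hi).bdd
  exact ⟨Finset.measurable_fun_sum s fun i hi => (hF i hi).measurable, ∑ i ∈ s, C i,
    fun x => (Finset.abs_sum_le_sum_abs _ _).trans (Finset.sum_le_sum fun i hi => hC i hi x)⟩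

lemma memLp (hf : BddMeasurable f) (p : ℝ≥0∞) (μ : Measure α) [IsFiniteMeasure μ] :
    MemLp f p μ := by
  obtain ⟨C, hC⟩ := hf.bdd
  exact MemLp.of_bound hf.measurable.aestronglyMeasurable C (ae_of_all _ hC)

lemma integrable (hf : BddMeasurable f) (μ : Measure α) [IsFiniteMeasure μ] : Integrable f μ :=
  (hf.memLp 1 μ).integrable le_rfl

end BddMeasurable

/-! ### Conditional laws -/

section CondLaw

variable {Ω α : Type*} [MeasurableSpace Ω] [MeasurableSpace α] {P : Measure Ω}

lemma cond_pi {ι : Type*} [Fintype ι] {β : ι → Type*} [∀ i, MeasurableSpace (β i)]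
    (ν : ∀ i, Measure (β i)) [∀ i, IsProbabilityMeasure (ν i)] {A : ∀ i, Set (β i)}
    (hA : ∀ i, MeasurableSet (A i)) (hpos : ∀ i, ν i (A i) ≠ 0) :
    (Measure.pi ν)[|Set.pi Set.univ A] = Measure.pi fun i => (ν i)[|A i] := by
  have (i : ι) : IsProbabilityMeasure ((ν i)[|A i]) := cond_isProbabilityMeasure (hpos i)
  refine (Measure.pi_eq fun B _ => ?_).symm
  rw [cond_apply (MeasurableSet.univ_pi hA), ← Set.pi_inter_distrib, Measure.pi_pi,
    Measure.pi_pi, ENNReal.prod_inv_distrib fun i _ j _ _ => Or.inr (measure_ne_top _ _),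
    ← Finset.prod_mul_distrib]
  simp only [cond_apply (hA _)]

lemma hasLaw_cond_preimage {X : Ω → α} {ν : Measure α} (hX : HasLaw X ν P) (hXm : Measurable X)
    {A : Set α} (hA : MeasurableSet A) : HasLaw X (ν[|A]) (P[|X ⁻¹' A]) where
  aemeasurable := hXm.aemeasurable
  map_eq := by
    ext B hB
    rw [Measure.map_apply hXm hB, cond_apply (hXm hA), cond_apply hA, ← hX.map_eq,
      Measure.map_apply hXm hA, Measure.map_apply hXm (hA.inter hB), Set.preimage_inter]

lemma hasLaw_cond_of_indepFun [IsFiniteMeasure P] {β : Type*} [MeasurableSpace β] {X : Ω → α}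
    {Y : Ω → β} {ν : Measure α} (hX : HasLaw X ν P) (hXm : Measurable X) (hY : Measurable Y)
    (hXY : IndepFun X Y P) {B : Set β} (hB : MeasurableSet B) (hpos : P (Y ⁻¹' B) ≠ 0) :
    HasLaw X ν (P[|Y ⁻¹' B]) where
  aemeasurable := hXm.aemeasurable
  map_eq := by
    ext A hA
    rw [Measure.map_apply hXm hA, cond_apply (hY hB), Set.inter_comm,
      hXY.measure_inter_preimage_eq_mul _ _ hA hB, mul_comm, mul_assoc,
      ENNReal.mul_inv_cancel hpos (measure_ne_top _ _), mul_one, ← Measure.map_apply hXm hA,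
      hX.map_eq]

variable {T : Type*} [MeasurableSpace T] [MeasurableSingletonClass T] {X : Ω → T}

lemma integral_eq_sum_integral_cond [Fintype T] {F : Type*} [NormedAddCommGroup F]
    [NormedSpace ℝ F] [IsFiniteMeasure P] (hX : Measurable X) {G : Ω → F} (hG : Integrable G P) :
    ∫ ω, G ω ∂P = ∑ t, P.real (X ⁻¹' {t}) • ∫ ω, G ω ∂P[|X ← t] := by
  conv_lhs => rw [← sum_meas_smul_cond_fiber hX P]
  rw [← sum_meas_smul_cond_fiber hX P, integrable_finsetSum_measure] at hG
  rw [integral_finsetSum_measure hG]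
  simp only [integral_smul_measure, measureReal_def]

lemma integral_eq_of_forall_integral_cond_eq [Finite T] [IsFiniteMeasure P] (hX : Measurable X)
    {G H : Ω → ℂ} (hG : Integrable G P) (hH : Integrable H P)
    (h : ∀ t, P (X ⁻¹' {t}) ≠ 0 → ∫ ω, G ω ∂P[|X ← t] = ∫ ω, H ω ∂P[|X ← t]) :
    ∫ ω, G ω ∂P = ∫ ω, H ω ∂P := by
  have := Fintype.ofFinite T
  rw [integral_eq_sum_integral_cond hX hG, integral_eq_sum_integral_cond hX hH]
  refine Finset.sum_congr rfl fun t _ => ?_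
  by_cases ht : P (X ⁻¹' {t}) = 0
  · simp [measureReal_def, ht]
  · rw [h t ht]

lemma integral_eq_integral_integral_of_hasLaw_cond [Finite T] [IsFiniteMeasure P]
    (hX : Measurable X) {U : Ω → α} (hU : Measurable U) {ν : T → Measure α}
    (hlaw : ∀ t, P (X ⁻¹' {t}) ≠ 0 → HasLaw U (ν t) (P[|X ← t])) {F : T → α → ℂ}
    (hF : ∀ t, Measurable (F t)) {C : ℝ} (hC : ∀ t u, ‖F t u‖ ≤ C) :
    ∫ ω, F (X ω) (U ω) ∂P = ∫ ω, ∫ u, F (X ω) u ∂ν (X ω) ∂P := by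
  have hF' : Measurable fun x : T × α => F x.1 x.2 := measurable_from_prod_countable_right hF
  refine integral_eq_of_forall_integral_cond_eq hX
    (Integrable.of_bound (hF'.comp (hX.prodMk hU)).aestronglyMeasurable C
      (ae_of_all _ fun _ => hC _ _))
    (Integrable.comp_measurable (f := X) (g := fun t => ∫ u, F t u ∂ν t) .of_finite hX)
    fun t ht => ?_
  have : IsProbabilityMeasure (P[|X ← t]) := cond_isProbabilityMeasure ht
  have hXt : ∀ᵐ ω ∂P[|X ← t], X ω = t := ae_cond_mem (hX (measurableSet_singleton t))
  calc ∫ ω, F (X ω) (U ω) ∂P[|X ← t]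
      = ∫ ω, F t (U ω) ∂P[|X ← t] := integral_congr_ae (by filter_upwards [hXt] with ω h; rw [h])
    _ = ∫ u, F t u ∂ν t := (hlaw t ht).integral_comp (hF t).aestronglyMeasurable
    _ = ∫ _, ∫ u, F t u ∂ν t ∂P[|X ← t] := by simp
    _ = ∫ ω, ∫ u, F (X ω) u ∂ν (X ω) ∂P[|X ← t] :=
        integral_congr_ae (by filter_upwards [hXt] with ω h; rw [h])

end CondLaw

/-! ### The sample given the design -/

variable {Ω : Type*} {K M d : ℕ}

/-- The law of the characteristics of a unit in stratum `s`. -/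
def stratumLaw (Q : Measure (UnitData K M d)) (s : Fin M) : Measure (UnitData K M d) :=
  Q[|(fun u => u.2.1) ⁻¹' {s}]

lemma ae_stratumLaw (Q : Measure (UnitData K M d)) (s : Fin M) :
    ∀ᵐ u ∂stratumLaw Q s, u.2.1 = s :=
  ae_cond_mem ((measurable_fst.comp measurable_snd) (measurableSet_singleton s))

lemma integral_stratumLaw_strat (Q : Measure (UnitData K M d)) (s : Fin M)
    (F : Fin M → UnitData K M d → ℝ) :
    ∫ u, F u.2.1 u ∂stratumLaw Q s = ∫ u, F s u ∂stratumLaw Q s :=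
  integral_congr_ae ((ae_stratumLaw Q s).mono fun u hu => by simp only [hu])

lemma integral_eq_sum_stratumLaw (Q : Measure (UnitData K M d)) [IsFiniteMeasure Q]
    {f : UnitData K M d → ℝ} (hf : BddMeasurable f) :
    ∫ u, f u ∂Q = ∑ s, Q.real {u | u.2.1 = s} * ∫ u, f u ∂stratumLaw Q s :=
  integral_eq_sum_integral_cond (measurable_fst.comp measurable_snd) (hf.integrable Q)

/-- The part of a sample on which the randomization operates: its strata and its assignments. -/
abbrev Design (K M n : ℕ) : Type := (Fin n → Fin M) × (Fin n → Fin K)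

/-- The design of the sample of size `n`. -/
def Experiment.design (E : Experiment Ω K M d) (n : ℕ) (ω : Ω) : Design K M n :=
  (fun i => E.strat n i ω, fun i => E.treat n i ω)

/-- The empirical assignment probabilities of a design (`0` on an empty stratum), so that
`Experiment.piHat` is a function of the design. -/
def Design.piHat {n : ℕ} (t : Design K M n) (w : Fin K) (s : Fin M) : ℝ :=
  ((Finset.univ.filter fun i => t.2 i = w ∧ t.1 i = s).card : ℝ) /
    ((Finset.univ.filter fun i => t.1 i = s).card : ℝ)

lemma Experiment.nStrat_div_mul_piHat (E : Experiment Ω K M d) (n : ℕ) (w : Fin K) (s : Fin M)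
    (ω : Ω) : (E.nStrat n s ω : ℝ) / n * E.piHat n w s ω = (E.nTreat n w s ω : ℝ) / n := by
  have hle : E.nTreat n w s ω ≤ E.nStrat n s ω :=
    Finset.card_le_card (Finset.monotone_filter_right _ fun _ _ h => h.2)
  rw [Experiment.piHat, div_mul_eq_mul_div, mul_div_cancel_of_imp']
  exact_mod_cast fun h : E.nStrat n s ω = 0 => Nat.eq_zero_of_le_zero (hle.trans h.le)

lemma Experiment.piHat_design (E : Experiment Ω K M d) (n : ℕ) (w : Fin K) (s : Fin M) (ω : Ω) :
    (E.design n ω).piHat w s = E.piHat n w s ω :=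
  rfl

namespace Experiment.IsCAR

variable [MeasurableSpace Ω] {P : Measure Ω} {Q : Measure (UnitData K M d)}
  {E : Experiment Ω K M d} {π : Fin K → Fin M → ℝ}

lemma measurable_strat (hE : E.IsCAR P Q π) (n : ℕ) (i : Fin n) : Measurable (E.strat n i) :=
  measurable_fst.comp (measurable_snd.comp (hE.measurable_unit n i))

lemma measurable_units (hE : E.IsCAR P Q π) (n : ℕ) : Measurable fun ω i => E.unit n i ω :=
  measurable_pi_lambda _ (hE.measurable_unit n)

lemma measurable_design (hE : E.IsCAR P Q π) (n : ℕ) : Measurable (E.design n) :=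
  (measurable_pi_lambda _ (hE.measurable_strat n)).prodMk
    (measurable_pi_lambda _ (hE.measurable_treat n))

lemma indepFun_units_treat_cond_strat (hE : E.IsCAR P Q π) (n : ℕ) (s : Fin n → Fin M) :
    IndepFun (fun ω i => E.unit n i ω) (fun ω i => E.treat n i ω)
      (P[|{ω | ∀ i, E.strat n i ω = s i}]) := by
  have hunit : Measurable fun (z : Fin n → (Fin K → ℝ) × (Fin d → ℝ)) i =>
      (((z i).1, s i, (z i).2) : UnitData K M d) := by fun_prop
  have hA : MeasurableSet {ω | ∀ i, E.strat n i ω = s i} := by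
    simp only [Set.ofPred_forall]
    exact .iInter fun i => hE.measurable_strat n i (measurableSet_singleton _)
  refine ((hE.condIndep n s).comp hunit measurable_id).congr ?_ .rfl
  filter_upwards [ae_cond_mem hA] with ω hω
  exact funext fun i => by simp only [Function.comp_apply, Experiment.unit, ← hω i]

lemma tendsto_nStrat_div [IsProbabilityMeasure P] (hE : E.IsCAR P Q π) (s : Fin M) :
    Tendsto (fun x : ℕ × Ω => (E.nStrat x.1 s x.2 : ℝ) / x.1) (whp P atTop)
      (𝓝 (Q.real {u | u.2.1 = s})) := by
  set ind : UnitData K M d → ℝ := Set.indicator {u | u.2.1 = s} 1 with hind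
  have hs : MeasurableSet {u : UnitData K M d | u.2.1 = s} :=
    (measurable_fst.comp measurable_snd) (measurableSet_singleton s)
  have hm : Measurable ind := measurable_one.indicator hs
  have h01 : ∀ u, ind u ∈ Set.Icc (0 : ℝ) 1 := fun u => by
    simp only [hind, Set.indicator_apply]
    split_ifs <;> simp
  have hL : ∀ n i, MemLp (fun ω => ind (E.unit n i ω)) 2 P := fun n i =>
    MemLp.of_bound (hm.comp (hE.measurable_unit n i)).aestronglyMeasurable 1
      (ae_of_all _ fun ω => abs_le.2 ⟨by linarith [(h01 (E.unit n i ω)).1], (h01 _).2⟩)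
  refine (tendsto_whp_average (V := ((1 - 0) / 2) ^ 2) hL
    (fun n i j hij => ((hE.indep n).indepFun hij).comp hm hm) (fun n i => ?_)
    fun n i => variance_le_sq_of_bounded (ae_of_all _ fun ω => h01 _) (hL n i).aemeasurable).congr
    fun x => ?_
  · rw [← integral_indicator_one hs]
    exact (hE.law n i).integral_comp hm.aestronglyMeasurable
  · simp [Experiment.nStrat, hind, Set.indicator_apply, Experiment.unit]

lemma tendsto_piHat_whp (hE : E.IsCAR P Q π) :
    Tendsto (fun x : ℕ × Ω => (E.design x.1 x.2).piHat) (whp P atTop) (𝓝 π) := by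
  simp only [tendsto_pi_nhds, piHat_design]
  exact fun w s => (tendstoInMeasure_const_iff_tendsto_whp (f := fun n => E.piHat n w s)).1
    (hE.tendsto_piHat w s)

lemma tendsto_nTreat_div [IsProbabilityMeasure P] (hE : E.IsCAR P Q π) (w : Fin K) (s : Fin M) :
    Tendsto (fun x : ℕ × Ω => (E.nTreat x.1 w s x.2 : ℝ) / x.1) (whp P atTop)
      (𝓝 (Q.real {u | u.2.1 = s} * π w s)) := by
  have hpi := tendsto_pi_nhds.1 (tendsto_pi_nhds.1 hE.tendsto_piHat_whp w) s
  simp only [piHat_design] at hpi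
  exact ((hE.tendsto_nStrat_div s).mul hpi).congr fun x => E.nStrat_div_mul_piHat x.1 w s x.2

variable [IsProbabilityMeasure Q]

lemma isProbabilityMeasure_stratumLaw (hE : E.IsCAR P Q π) (s : Fin M) :
    IsProbabilityMeasure (stratumLaw Q s) :=
  cond_isProbabilityMeasure (hE.strat_pos s).ne'

lemma hasLaw_units_cond_strat (hE : E.IsCAR P Q π) (n : ℕ) (s : Fin n → Fin M) :
    HasLaw (fun ω i => E.unit n i ω) (Measure.pi fun i => stratumLaw Q (s i))
      (P[|{ω | ∀ i, E.strat n i ω = s i}]) := by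
  have hstrat : ∀ i, MeasurableSet ((fun u : UnitData K M d => u.2.1) ⁻¹' {s i}) := fun i =>
    (measurable_fst.comp measurable_snd) (measurableSet_singleton _)
  have hlaw := hasLaw_cond_preimage ((hE.indep n).hasLaw_pi (hE.law n)) (hE.measurable_units n)
    (MeasurableSet.univ_pi hstrat)
  rw [cond_pi _ hstrat fun i => (hE.strat_pos (s i)).ne'] at hlaw
  have hset : {ω | ∀ i, E.strat n i ω = s i} = (fun ω i => E.unit n i ω) ⁻¹'
      Set.univ.pi fun i => (fun u : UnitData K M d => u.2.1) ⁻¹' {s i} := by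
    ext ω
    simp [Experiment.unit]
  rwa [hset]

variable [IsProbabilityMeasure P]

lemma hasLaw_units_cond_design (hE : E.IsCAR P Q π) (n : ℕ) (t : Design K M n)
    (ht : P (E.design n ⁻¹' {t}) ≠ 0) :
    HasLaw (fun ω i => E.unit n i ω) (Measure.pi fun i => stratumLaw Q (t.1 i))
      (P[|E.design n ← t]) := by
  set A := {ω | ∀ i, E.strat n i ω = t.1 i}
  set B := (fun ω i => E.treat n i ω) ⁻¹' {t.2}
  have hA : MeasurableSet A := by
    simp only [A, Set.ofPred_forall]
    exact .iInter fun i => hE.measurable_strat n i (measurableSet_singleton _)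
  have htreat : Measurable fun ω i => E.treat n i ω :=
    measurable_pi_lambda _ (hE.measurable_treat n)
  have hB : MeasurableSet B := htreat (measurableSet_singleton _)
  have hAB : E.design n ⁻¹' {t} = A ∩ B := by
    ext ω
    simp [A, B, Experiment.design, Prod.ext_iff, funext_iff]
  rw [hAB] at ht ⊢
  rw [← cond_cond_eq_cond_inter hA hB]
  exact hasLaw_cond_of_indepFun (hE.hasLaw_units_cond_strat n t.1) (hE.measurable_units n) htreat
    (hE.indepFun_units_treat_cond_strat n t.1) (measurableSet_singleton _)
    (cond_pos_of_inter_ne_zero hA ht).ne'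

lemma integral_prod_units (hE : E.IsCAR P Q π) {n : ℕ}
    {h : Design K M n → Fin n → UnitData K M d → ℂ} (hm : ∀ t i, Measurable (h t i))
    (hbd : ∀ t i u, ‖h t i u‖ ≤ 1) :
    ∫ ω, ∏ i, h (E.design n ω) i (E.unit n i ω) ∂P
      = ∫ ω, ∏ i, ∫ u, h (E.design n ω) i u ∂stratumLaw Q (E.strat n i ω) ∂P := by
  have := hE.isProbabilityMeasure_stratumLaw
  rw [integral_eq_integral_integral_of_hasLaw_cond (hE.measurable_design n) (hE.measurable_units n)
    (hE.hasLaw_units_cond_design n) (F := fun t u => ∏ i, h t i (u i)) (C := 1)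
    (fun t => Finset.measurable_fun_prod _ fun i _ => (hm t i).comp (measurable_pi_apply i))
    fun t u => ?_]
  · simp only [integral_fintype_prod_eq_prod]
    rfl
  · rw [norm_prod]
    exact Finset.prod_le_one (fun _ _ => norm_nonneg _) fun i _ => hbd t i _

end Experiment.IsCAR

/-! ### Asymptotic normality of score sums -/

/-- A bounded influence function that depends on the assignment probabilities `c` and on the
treatment `v` of the unit: it has mean zero in every stratum, so that sums of it have mean zero
given the design, and it is continuous at the target `π`, uniformly bounded near it. -/
structure IsRegularScore (Q : Measure (UnitData K M d)) (π : Fin K → Fin M → ℝ)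
    (f : (Fin K → Fin M → ℝ) → Fin K → UnitData K M d → ℝ) : Prop where
  bddMeasurable : ∀ c v, BddMeasurable (f c v)
  eventually_bdd : ∃ C, ∀ᶠ c in 𝓝 π, ∀ v u, |f c v u| ≤ C
  continuousAt : ∀ v u, ContinuousAt (fun c => f c v u) π
  integral_eq_zero : ∀ c v s, ∫ u, f c v u ∂stratumLaw Q s = 0

/-- The normalized sum over a sample of the score `f`, evaluated at the empirical assignment
probabilities, and of a function `ζ` of the stratum. -/
def Experiment.scoreSum (E : Experiment Ω K M d)
    (f : (Fin K → Fin M → ℝ) → Fin K → UnitData K M d → ℝ) (ζ : Fin M → ℝ) (n : ℕ) (ω : Ω) : ℝ :=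
  (∑ i, (f (E.design n ω).piHat (E.treat n i ω) (E.unit n i ω) + ζ (E.strat n i ω))) / √n

/-- The characteristic function at `t / √n` of the score of a unit in stratum `s` that receives
treatment `v`, under the assignment probabilities `c`. -/
def stratumCharFun (Q : Measure (UnitData K M d))
    (f : (Fin K → Fin M → ℝ) → Fin K → UnitData K M d → ℝ) (t : ℝ) (n : ℕ)
    (c : Fin K → Fin M → ℝ) (v : Fin K) (s : Fin M) : ℂ :=
  ∫ u, Complex.exp ((t * f c v u / √n : ℝ) * Complex.I) ∂stratumLaw Q s

lemma norm_stratumCharFun_le_one (Q : Measure (UnitData K M d))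
    (f : (Fin K → Fin M → ℝ) → Fin K → UnitData K M d → ℝ) (t : ℝ) (n : ℕ)
    (c : Fin K → Fin M → ℝ) (v : Fin K) (s : Fin M) [IsProbabilityMeasure (stratumLaw Q s)] :
    ‖stratumCharFun Q f t n c v s‖ ≤ 1 := by
  simpa only [stratumCharFun, probReal_univ, mul_one] using norm_integral_le_of_norm_le_const
    (ae_of_all (stratumLaw Q s) fun u => (Complex.norm_exp_ofReal_mul_I (t * f c v u / √n)).le)

/-- The asymptotic variance of `Experiment.scoreSum`. -/
def scoreVariance (Q : Measure (UnitData K M d)) (π : Fin K → Fin M → ℝ)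
    (f : (Fin K → Fin M → ℝ) → Fin K → UnitData K M d → ℝ) (ζ : Fin M → ℝ) : ℝ :=
  ∫ u, (∑ v, π v u.2.1 * f π v u ^ 2 + ζ u.2.1 ^ 2) ∂Q

lemma bddMeasurable_comp_strat (ζ : Fin M → ℝ) :
    BddMeasurable fun u : UnitData K M d => ζ u.2.1 :=
  (BddMeasurable.of_finite ζ).comp (measurable_fst.comp measurable_snd)

lemma Experiment.prod_comp_design (E : Experiment Ω K M d) (n : ℕ) (ω : Ω)
    (z : Fin K → Fin M → ℂ) :
    ∏ i, z (E.treat n i ω) (E.strat n i ω) = ∏ v, ∏ s, z v s ^ E.nTreat n v s ω := by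
  rw [← Finset.prod_product', Finset.univ_product_univ,
    ← Finset.prod_fiberwise' Finset.univ (fun i => (E.treat n i ω, E.strat n i ω))
      fun x => z x.1 x.2]
  simp only [Finset.prod_const, Experiment.nTreat, Prod.ext_iff]

namespace IsRegularScore

variable {Q : Measure (UnitData K M d)} {π : Fin K → Fin M → ℝ}
  {f : (Fin K → Fin M → ℝ) → Fin K → UnitData K M d → ℝ}

lemma tendsto_mul_stratumCharFun_sub_one (hf : IsRegularScore Q π f) (t : ℝ) (v : Fin K)
    (s : Fin M) [IsProbabilityMeasure (stratumLaw Q s)] {ι : Type*} {l : Filter ι} {N : ι → ℕ}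
    {c : ι → Fin K → Fin M → ℝ} (hN : Tendsto N l atTop) (hc : Tendsto c l (𝓝 π)) :
    Tendsto (fun j => (N j : ℂ) * (stratumCharFun Q f t (N j) (c j) v s - 1)) l
      (𝓝 ((-(t ^ 2 * ∫ u, f π v u ^ 2 ∂stratumLaw Q s) / 2 : ℝ) : ℂ)) := by
  obtain ⟨C, hC⟩ := hf.eventually_bdd
  have hbd : ∀ᶠ x in (atTop : Filter ℕ) ×ˢ 𝓝 π, ∀ u, |t * f x.2 v u| ≤ |t| * C := by
    filter_upwards [tendsto_snd.eventually hC] with x hx u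
    rw [abs_mul]
    gcongr
    exact hx v u
  have hlim := tendsto_natCast_mul_integral_exp_sub_one (stratumLaw Q s) tendsto_fst
    (fun x => (hf.bddMeasurable x.2 v).measurable.const_mul t) hbd
    (fun u => ((hf.continuousAt v u).tendsto.comp tendsto_snd).const_mul t)
    fun x => by rw [integral_const_mul, hf.integral_eq_zero, mul_zero]
  simp only [mul_pow, integral_const_mul] at hlim
  have hpair : Tendsto (fun j => (N j, c j)) l (atTop ×ˢ 𝓝 π) := hN.prodMk hc
  simpa only [stratumCharFun, Function.comp_def] using hlim.comp hpair

end IsRegularScore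

namespace Experiment.IsCAR

variable [MeasurableSpace Ω] {P : Measure Ω} {Q : Measure (UnitData K M d)}
  {E : Experiment Ω K M d} {π : Fin K → Fin M → ℝ}
  {f : (Fin K → Fin M → ℝ) → Fin K → UnitData K M d → ℝ} {ζ : Fin M → ℝ}

lemma measurable_scoreSum (hE : E.IsCAR P Q π) (hf : ∀ c v, Measurable (f c v)) (n : ℕ) :
    Measurable (E.scoreSum f ζ n) := by
  unfold Experiment.scoreSum
  refine (Finset.measurable_fun_sum _ fun i _ => Measurable.add ?_ ?_).div_const _
  · have hF : Measurable fun x : Design K M n × UnitData K M d => f x.1.piHat (x.1.2 i) x.2 :=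
      measurable_from_prod_countable_right fun D => hf D.piHat (D.2 i)
    have hdu := (hE.measurable_design n).prodMk (hE.measurable_unit n i)
    simpa only [Function.comp_def, Experiment.design] using hF.comp hdu
  · exact (measurable_of_finite ζ).comp (hE.measurable_strat n i)

variable [IsProbabilityMeasure Q]

lemma tendsto_integral_prod_exp_strat (hE : E.IsCAR P Q π) (hζ : ∫ u, ζ u.2.1 ∂Q = 0) (t : ℝ) :
    Tendsto (fun n => ∫ ω, ∏ i, Complex.exp ((t * ζ (E.strat n i ω) / √n : ℝ) * Complex.I) ∂P)
      atTop (𝓝 (Complex.exp ((-(t ^ 2 * ∫ u, ζ u.2.1 ^ 2 ∂Q) / 2 : ℝ) : ℂ))) := by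
  have hb := (BddMeasurable.const t).mul (bddMeasurable_comp_strat (K := K) (d := d) ζ)
  obtain ⟨C, hC⟩ := hb.bdd
  have hiid (n : ℕ) : ∫ ω, ∏ i, Complex.exp ((t * ζ (E.strat n i ω) / √n : ℝ) * Complex.I) ∂P
      = (∫ u, Complex.exp ((t * ζ u.2.1 / √n : ℝ) * Complex.I) ∂Q) ^ n := by
    have hm : Measurable fun u : UnitData K M d =>
        Complex.exp ((t * ζ u.2.1 / √n : ℝ) * Complex.I) := by
      have := hb.measurable
      fun_prop
    refine ((hE.indep n).integral_fun_prod_comp (fun i => (hE.measurable_unit n i).aemeasurable)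
      fun i => hm.aestronglyMeasurable).trans ?_
    refine (Finset.prod_congr rfl fun i _ =>
      (hE.law n i).integral_comp hm.aestronglyMeasurable).trans ?_
    simp
  have hmul := tendsto_natCast_mul_integral_exp_sub_one Q (N := fun n => n)
    (a := fun _ u => t * ζ u.2.1) tendsto_id (fun _ => hb.measurable)
    (Eventually.of_forall fun _ => hC) (fun u => tendsto_const_nhds)
    fun _ => by rw [integral_const_mul, hζ, mul_zero]
  have hone : Tendsto (fun n : ℕ => (n : ℝ) / n) atTop (𝓝 1) :=
    tendsto_const_nhds.congr' <| (eventually_ne_atTop 0).mono fun n hn =>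
      (div_self (Nat.cast_ne_zero.2 hn)).symm
  have hpow := tendsto_pow_of_tendsto_mul_sub_one tendsto_id hmul hone
  simp only [hiid]
  simpa only [mul_pow, integral_const_mul, Complex.ofReal_one, one_mul] using hpow

variable [IsProbabilityMeasure P]

lemma integral_exp_scoreSum (hE : E.IsCAR P Q π) (hf : ∀ c v, Measurable (f c v)) (t : ℝ) (n : ℕ) :
    ∫ ω, Complex.exp ((t * E.scoreSum f ζ n ω : ℝ) * Complex.I) ∂P
      = ∫ ω, (∏ i, Complex.exp ((t * ζ (E.strat n i ω) / √n : ℝ) * Complex.I))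
          * ∏ i, stratumCharFun Q f t n (E.design n ω).piHat (E.treat n i ω) (E.strat n i ω)
        ∂P := by
  have key := hE.integral_prod_units (n := n)
    (h := fun D i u => Complex.exp ((t * ζ (D.1 i) / √n : ℝ) * Complex.I)
      * Complex.exp ((t * f D.piHat (D.2 i) u / √n : ℝ) * Complex.I))
    (fun D i => by have := hf D.piHat (D.2 i); fun_prop)
    (fun D i u => by simp only [norm_mul, Complex.norm_exp_ofReal_mul_I, one_mul, le_refl])
  simp only [integral_const_mul, Finset.prod_mul_distrib] at key
  refine Eq.trans (integral_congr_ae (ae_of_all _ fun ω => ?_)) key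
  simp only [← Complex.exp_sum, ← Complex.exp_add, Experiment.scoreSum, Finset.sum_div,
    Finset.mul_sum, Complex.ofReal_sum, Finset.sum_mul, ← Finset.sum_add_distrib]
  congr 1
  refine Finset.sum_congr rfl fun i _ => ?_
  simp only [Experiment.design]
  push_cast
  ring

lemma tendsto_prod_stratumCharFun_whp (hE : E.IsCAR P Q π) (hf : IsRegularScore Q π f) (t : ℝ) :
    Tendsto (fun x : ℕ × Ω => ∏ i, stratumCharFun Q f t x.1 (E.design x.1 x.2).piHat
        (E.treat x.1 i x.2) (E.strat x.1 i x.2)) (whp P atTop)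
      (𝓝 (Complex.exp ((-(t ^ 2 * ∫ u, ∑ v, π v u.2.1 * f π v u ^ 2 ∂Q) / 2 : ℝ) : ℂ))) := by
  have := hE.isProbabilityMeasure_stratumLaw
  have hvar : ∫ u, ∑ v, π v u.2.1 * f π v u ^ 2 ∂Q
      = ∑ v, ∑ s, Q.real {u | u.2.1 = s} * π v s * ∫ u, f π v u ^ 2 ∂stratumLaw Q s := by
    have hb (v : Fin K) : BddMeasurable fun u : UnitData K M d => π v u.2.1 * f π v u ^ 2 :=
      (bddMeasurable_comp_strat (π v)).mul ((hf.bddMeasurable π v).pow 2)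
    rw [integral_finsetSum _ fun v _ => (hb v).integrable Q]
    refine Finset.sum_congr rfl fun v _ => ?_
    rw [integral_eq_sum_stratumLaw Q (hb v)]
    refine Finset.sum_congr rfl fun s _ => ?_
    rw [integral_stratumLaw_strat Q s fun s u => π v s * f π v u ^ 2, integral_const_mul, mul_assoc]
  have hpow (v : Fin K) (s : Fin M) := tendsto_pow_of_tendsto_mul_sub_one tendsto_fst_whp
    (hf.tendsto_mul_stratumCharFun_sub_one t v s tendsto_fst_whp hE.tendsto_piHat_whp)
    (hE.tendsto_nTreat_div v s)
  simp only [Experiment.prod_comp_design]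
  have hinner (v : Fin K) := tendsto_finsetProd Finset.univ fun s _ => hpow v s
  convert tendsto_finsetProd Finset.univ fun v _ => hinner v using 2
  simp only [← Complex.exp_sum, hvar, Finset.mul_sum, Finset.sum_div,
    ← Finset.sum_neg_distrib, Complex.ofReal_sum]
  congr 1
  refine Finset.sum_congr rfl fun v _ => Finset.sum_congr rfl fun s _ => ?_
  push_cast
  ring

lemma tendsto_integral_exp_scoreSum (hE : E.IsCAR P Q π) (hf : IsRegularScore Q π f)
    (hζ : ∫ u, ζ u.2.1 ∂Q = 0) (t : ℝ) :
    Tendsto (fun n => ∫ ω, Complex.exp ((t * E.scoreSum f ζ n ω : ℝ) * Complex.I) ∂P) atTop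
      (𝓝 (Complex.exp ((-(t ^ 2 * scoreVariance Q π f ζ) / 2 : ℝ) : ℂ))) := by
  have := hE.isProbabilityMeasure_stratumLaw
  have hmeas (n : ℕ) (g : Design K M n → ℂ) : Measurable fun ω => g (E.design n ω) :=
    (measurable_of_finite g).comp (hE.measurable_design n)
  have hlim := tendsto_integral_mul_of_tendsto_whp (C := 1) (D := 1)
    (fun n => hmeas n fun D => ∏ i, Complex.exp ((t * ζ (D.1 i) / √n : ℝ) * Complex.I))
    (fun n => hmeas n fun D => ∏ i, stratumCharFun Q f t n D.piHat (D.2 i) (D.1 i))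
    (fun n ω => by simp only [norm_prod, Complex.norm_exp_ofReal_mul_I, Finset.prod_const_one,
      le_refl])
    (fun n ω => by
      rw [norm_prod]
      exact Finset.prod_le_one (fun _ _ => norm_nonneg _) fun i _ =>
        norm_stratumCharFun_le_one ..)
    (hE.tendsto_integral_prod_exp_strat hζ t) (hE.tendsto_prod_stratumCharFun_whp hf t)
  have hvar : scoreVariance Q π f ζ
      = ∫ u, ∑ v, π v u.2.1 * f π v u ^ 2 ∂Q + ∫ u, ζ u.2.1 ^ 2 ∂Q :=
    integral_add ((BddMeasurable.sum fun v _ => (bddMeasurable_comp_strat (π v)).mul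
      ((hf.bddMeasurable π v).pow 2)).integrable Q)
      (((bddMeasurable_comp_strat ζ).pow 2).integrable Q)
  simp only [hE.integral_exp_scoreSum fun c v => (hf.bddMeasurable c v).measurable]
  convert hlim using 2
  · rfl
  · rw [hvar, ← Complex.exp_add]
    congr 1
    push_cast
    ring

theorem tendstoInDistribution_scoreSum (hE : E.IsCAR P Q π) (hf : IsRegularScore Q π f)
    (hζ : ∫ u, ζ u.2.1 ∂Q = 0) :
    TendstoInDistribution (E.scoreSum f ζ) atTop (id : ℝ → ℝ) (fun _ => P)
      (gaussianReal 0 (scoreVariance Q π f ζ).toNNReal) := by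
  have hm := hE.measurable_scoreSum (ζ := ζ) fun c v => (hf.bddMeasurable c v).measurable
  have hvar : 0 ≤ scoreVariance Q π f ζ := integral_nonneg fun u => by
    have (v : Fin K) := (hE.target_mem v u.2.1).1.le
    exact add_nonneg (Finset.sum_nonneg fun v _ => mul_nonneg (this v) (sq_nonneg _)) (sq_nonneg _)
  refine ⟨fun n => (hm n).aemeasurable, aemeasurable_id,
    ProbabilityMeasure.tendsto_of_tendsto_charFun fun t => ?_⟩
  change Tendsto (fun n => charFun (P.map (E.scoreSum f ζ n)) t) atTop
    (𝓝 (charFun (Measure.map id (gaussianReal 0 (scoreVariance Q π f ζ).toNNReal)) t))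
  rw [Measure.map_id, charFun_gaussianReal]
  convert hE.tendsto_integral_exp_scoreSum hf hζ t using 2 with n
  · rw [charFun_apply_real, integral_map (hm n).aemeasurable (by fun_prop)]
    push_cast
    rfl
  · rw [Real.coe_toNNReal _ hvar]
    push_cast
    ring_nf

end Experiment.IsCAR

/-! ### The score of the regression-adjusted estimator -/

/-- The mean of `g` in stratum `s`. -/
def stratumMean (Q : Measure (UnitData K M d)) (g : UnitData K M d → ℝ) (s : Fin M) : ℝ :=
  ∫ u, g u ∂stratumLaw Q s

/-- The deviation of `g` from its mean in the stratum of the unit. -/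
def centered (Q : Measure (UnitData K M d)) (g : UnitData K M d → ℝ) (u : UnitData K M d) : ℝ :=
  g u - stratumMean Q g u.2.1

/-- The inverse probability weight that a unit in stratum `s` with treatment `v` receives in the
estimation of the outcome distribution under treatment `w`. -/
def ipWeight (c : Fin K → Fin M → ℝ) (w v : Fin K) (s : Fin M) : ℝ :=
  if v = w then (c w s)⁻¹ else 0

/-- The indicator of `Y(w) ≤ y`. -/
def outcomeInd (w : Fin K) (y : ℝ) (u : UnitData K M d) : ℝ :=
  if u.1 w ≤ y then 1 else 0

/-- The error `1{Y(w) ≤ y} - m(S, X)` of the adjustment term `m`. -/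
def residual (w : Fin K) (y : ℝ) (m : Fin M → (Fin d → ℝ) → ℝ) (u : UnitData K M d) : ℝ :=
  outcomeInd w y u - m u.2.1 u.2.2

/-- The stratum-centered contribution of a unit with treatment `v` to `Experiment.cdfAIPW`, for
assignment probabilities `c`. -/
def armScore (Q : Measure (UnitData K M d)) (w : Fin K) (y : ℝ) (m : Fin M → (Fin d → ℝ) → ℝ)
    (c : Fin K → Fin M → ℝ) (v : Fin K) (u : UnitData K M d) : ℝ :=
  ipWeight c w v u.2.1 * centered Q (residual w y m) u + centered Q (fun u => m u.2.1 u.2.2) u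

/-- The score of the difference of two regression-adjusted estimators. -/
def dteScore (Q : Measure (UnitData K M d)) (w w' : Fin K) (y : ℝ)
    (m m' : Fin M → (Fin d → ℝ) → ℝ) (c : Fin K → Fin M → ℝ) (v : Fin K) (u : UnitData K M d) : ℝ :=
  armScore Q w y m c v u - armScore Q w' y m' c v u

section centered

variable {Q : Measure (UnitData K M d)} {g h : UnitData K M d → ℝ}

lemma BddMeasurable.centered (hg : BddMeasurable g) : BddMeasurable (centered Q g) :=
  hg.sub (bddMeasurable_comp_strat _)

lemma integral_centered (hg : BddMeasurable g) (s : Fin M) [IsProbabilityMeasure (stratumLaw Q s)] :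
    ∫ u, centered Q g u ∂stratumLaw Q s = 0 := by
  have hstrat := integral_stratumLaw_strat Q s fun s u => g u - stratumMean Q g s
  rw [integral_sub (hg.integrable _) (integrable_const _)] at hstrat
  simpa [centered, stratumMean] using hstrat

lemma integral_comp_strat_stratumMean [IsFiniteMeasure Q]
    [∀ s, IsProbabilityMeasure (stratumLaw Q s)] (hg : BddMeasurable g) :
    ∫ u, stratumMean Q g u.2.1 ∂Q = ∫ u, g u ∂Q := by
  rw [integral_eq_sum_stratumLaw Q hg,
    integral_eq_sum_stratumLaw Q (bddMeasurable_comp_strat (stratumMean Q g))]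
  refine Finset.sum_congr rfl fun s _ => ?_
  rw [integral_stratumLaw_strat Q s fun s _ => stratumMean Q g s, integral_const, probReal_univ,
    one_smul, stratumMean]

end centered

namespace IsRegularScore

variable {Q : Measure (UnitData K M d)} {π : Fin K → Fin M → ℝ}
  {f g : (Fin K → Fin M → ℝ) → Fin K → UnitData K M d → ℝ}

lemma weight_mul_centered [∀ s, IsProbabilityMeasure (stratumLaw Q s)]
    {a : (Fin K → Fin M → ℝ) → Fin K → Fin M → ℝ} (ha : ContinuousAt a π)
    {g : UnitData K M d → ℝ} (hg : BddMeasurable g) :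
    IsRegularScore Q π fun c v u => a c v u.2.1 * centered Q g u where
  bddMeasurable c v := (bddMeasurable_comp_strat (a c v)).mul hg.centered
  eventually_bdd := by
    obtain ⟨C, hC⟩ := (hg.centered (Q := Q)).bdd
    refine ⟨(‖a π‖ + 1) * C, ?_⟩
    filter_upwards [ha.norm.eventually_le_const (lt_add_one ‖a π‖)] with c hc v u
    have hentry : |a c v u.2.1| ≤ ‖a c‖ := (norm_le_pi_norm (a c v) _).trans (norm_le_pi_norm _ v)
    rw [abs_mul]
    exact mul_le_mul (hentry.trans hc) (hC u) (abs_nonneg _) (by positivity)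
  continuousAt v u :=
    (continuousAt_pi.1 (continuousAt_pi.1 ha v) u.2.1).mul_const _
  integral_eq_zero c v s := by
    rw [integral_stratumLaw_strat Q s fun s u => a c v s * centered Q g u, integral_const_mul,
      integral_centered hg, mul_zero]

lemma add [∀ s, IsProbabilityMeasure (stratumLaw Q s)] (hf : IsRegularScore Q π f)
    (hg : IsRegularScore Q π g) : IsRegularScore Q π fun c v u => f c v u + g c v u where
  bddMeasurable c v := (hf.bddMeasurable c v).add (hg.bddMeasurable c v)
  eventually_bdd := by
    obtain ⟨C, hC⟩ := hf.eventually_bdd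
    obtain ⟨D, hD⟩ := hg.eventually_bdd
    exact ⟨C + D, hC.mp <| hD.mono fun c hD hC v u =>
      (abs_add_le _ _).trans (add_le_add (hC v u) (hD v u))⟩
  continuousAt v u := (hf.continuousAt v u).add (hg.continuousAt v u)
  integral_eq_zero c v s := by
    rw [integral_add ((hf.bddMeasurable c v).integrable _) ((hg.bddMeasurable c v).integrable _),
      hf.integral_eq_zero, hg.integral_eq_zero, add_zero]

lemma neg (hf : IsRegularScore Q π f) : IsRegularScore Q π fun c v u => -f c v u where
  bddMeasurable c v := by
    simpa only [neg_one_mul] using (BddMeasurable.const (-1)).mul (hf.bddMeasurable c v)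
  eventually_bdd := by simpa only [abs_neg] using hf.eventually_bdd
  continuousAt v u := (hf.continuousAt v u).neg
  integral_eq_zero c v s := by rw [integral_neg, hf.integral_eq_zero, neg_zero]

end IsRegularScore

section dteScore

variable {Q : Measure (UnitData K M d)} {m m' : Fin M → (Fin d → ℝ) → ℝ}

lemma continuousAt_ipWeight {π : Fin K → Fin M → ℝ} {w : Fin K} (hπ : ∀ s, π w s ≠ 0) :
    ContinuousAt (fun c => ipWeight c w) π := by
  refine continuousAt_pi.2 fun v => continuousAt_pi.2 fun s => ?_
  unfold ipWeight
  split_ifs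
  · exact ((continuous_apply_apply w s).continuousAt).inv₀ (hπ s)
  · exact continuousAt_const

lemma measurableSet_outcome_le (w : Fin K) (y : ℝ) :
    MeasurableSet {u : UnitData K M d | u.1 w ≤ y} :=
  measurableSet_le (by fun_prop) measurable_const

lemma bddMeasurable_outcomeInd (w : Fin K) (y : ℝ) :
    BddMeasurable (outcomeInd w y : UnitData K M d → ℝ) :=
  ⟨Measurable.ite (measurableSet_outcome_le w y) measurable_const measurable_const, 1, fun u => by
    unfold outcomeInd
    split_ifs <;> simp⟩

lemma integral_outcomeInd (Q : Measure (UnitData K M d)) (w : Fin K) (y : ℝ) :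
    ∫ u, outcomeInd w y u ∂Q = popCDF Q w y :=
  integral_indicator_one (measurableSet_outcome_le w y)

lemma integral_dte_stratumLaw [IsProbabilityMeasure Q] [∀ s, IsProbabilityMeasure (stratumLaw Q s)]
    (w w' : Fin K) (y : ℝ) :
    ∫ u, (dte (stratumLaw Q u.2.1) w w' y - dte Q w w' y) ∂Q = 0 := by
  have hpop (v : Fin K) : ∫ u, popCDF (stratumLaw Q u.2.1) v y ∂Q = popCDF Q v y := by
    simpa only [stratumMean, integral_outcomeInd] using
      integral_comp_strat_stratumMean (bddMeasurable_outcomeInd v y)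
  have hint (F : Fin M → ℝ) := (bddMeasurable_comp_strat (K := K) (d := d) F).integrable Q
  rw [integral_sub (hint fun s => dte (stratumLaw Q s) w w' y) (integrable_const _)]
  simp only [dte]
  rw [integral_sub (hint fun s => popCDF (stratumLaw Q s) w y)
    (hint fun s => popCDF (stratumLaw Q s) w' y), hpop, hpop]
  simp

lemma bddMeasurable_residual (w : Fin K) (y : ℝ)
    (hm : BddMeasurable (Function.uncurry m)) :
    BddMeasurable (residual w y m : UnitData K M d → ℝ) :=
  (bddMeasurable_outcomeInd w y).sub (hm.comp measurable_snd)

lemma stratumMean_residual (w : Fin K) (y : ℝ) (s : Fin M) [IsProbabilityMeasure (stratumLaw Q s)]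
    (hm : BddMeasurable (Function.uncurry m)) :
    stratumMean Q (residual w y m) s
      = popCDF (stratumLaw Q s) w y - stratumMean Q (fun u => m u.2.1 u.2.2) s := by
  rw [← integral_outcomeInd]
  exact integral_sub ((bddMeasurable_outcomeInd w y).integrable _)
    ((hm.comp measurable_snd).integrable _)

variable [∀ s, IsProbabilityMeasure (stratumLaw Q s)] {π : Fin K → Fin M → ℝ}

lemma isRegularScore_armScore {w : Fin K} (y : ℝ) (hπ : ∀ s, π w s ≠ 0)
    (hm : BddMeasurable (Function.uncurry m)) :
    IsRegularScore Q π (armScore Q w y m) := by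
  have hconst := IsRegularScore.weight_mul_centered (Q := Q) (π := π) (a := fun _ _ _ => 1)
    continuousAt_const (hm.comp measurable_snd)
  simp only [one_mul] at hconst
  exact (IsRegularScore.weight_mul_centered (continuousAt_ipWeight hπ)
    (bddMeasurable_residual w y hm)).add hconst

lemma isRegularScore_dteScore (hπ : ∀ w s, π w s ≠ 0) (w w' : Fin K) (y : ℝ)
    (hm : BddMeasurable (Function.uncurry m))
    (hm' : BddMeasurable (Function.uncurry m')) :
    IsRegularScore Q π (dteScore Q w w' y m m') := by
  have h := (isRegularScore_armScore (Q := Q) y (hπ w) hm).add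
    (isRegularScore_armScore y (hπ w') hm').neg
  simp only [← sub_eq_add_neg] at h
  exact h

end dteScore

namespace Experiment

variable (E : Experiment Ω K M d) {Q : Measure (UnitData K M d)}
  {m m' : Fin M → (Fin d → ℝ) → ℝ} {n : ℕ} {ω : Ω}

lemma dteEmp_eq_cdfAIPW_zero_sub (w w' : Fin K) (y : ℝ) :
    E.dteEmp w w' y = fun n ω => E.cdfAIPW 0 n w y ω - E.cdfAIPW 0 n w' y ω := by
  funext n ω
  simp only [dteEmp, cdfAIPW, cdfEmp, Pi.zero_apply, sub_zero, add_zero]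

lemma sum_ipWeight_mul {w : Fin K} (hw : ∀ s, (E.design n ω).piHat w s ≠ 0) (κ : Fin M → ℝ) :
    ∑ i, ipWeight (E.design n ω).piHat w (E.treat n i ω) (E.strat n i ω) * κ (E.strat n i ω)
      = ∑ i, κ (E.strat n i ω) := by
  simp only [piHat_design] at hw
  rw [← Finset.sum_fiberwise Finset.univ (fun i => E.strat n i ω),
    ← Finset.sum_fiberwise Finset.univ (fun i => E.strat n i ω) (fun i => κ (E.strat n i ω))]
  refine Finset.sum_congr rfl fun s _ => ?_
  have hunits : ∑ i with E.strat n i ω = s, κ (E.strat n i ω) = E.nStrat n s ω * κ s := by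
    rw [Finset.sum_congr rfl (g := fun _ => κ s) fun i hi => by rw [(Finset.mem_filter.1 hi).2]]
    rw [Finset.sum_const, nsmul_eq_mul, nStrat]
  have htreated : ∑ i with E.strat n i ω = s,
      ipWeight (E.design n ω).piHat w (E.treat n i ω) (E.strat n i ω) * κ (E.strat n i ω)
      = E.nTreat n w s ω * ((E.piHat n w s ω)⁻¹ * κ s) := by
    rw [Finset.sum_congr rfl (g := fun i => if E.treat n i ω = w then
      (E.piHat n w s ω)⁻¹ * κ s else 0) fun i hi => by
        rw [(Finset.mem_filter.1 hi).2, ipWeight, ite_mul, zero_mul, piHat_design],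
      ← Finset.sum_filter, Finset.filter_filter, Finset.sum_const, nsmul_eq_mul]
    simp only [nTreat, and_comm]
  rw [hunits, htreated]
  have hs := hw s
  unfold piHat at hs ⊢
  have hnum : (E.nTreat n w s ω : ℝ) ≠ 0 := fun h => hs (by rw [h, zero_div])
  field_simp

lemma cdfAIPW_eq_ipWeight (m : Fin M → (Fin d → ℝ) → ℝ) (w : Fin K) (y : ℝ) :
    E.cdfAIPW m n w y ω = (∑ i, (ipWeight (E.design n ω).piHat w (E.treat n i ω) (E.strat n i ω)
      * residual w y m (E.unit n i ω) + m (E.strat n i ω) (E.cov n i ω))) / n := by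
  rw [cdfAIPW, one_div_mul_eq_div]
  congr 1
  refine Finset.sum_congr rfl fun i _ => ?_
  by_cases h : E.treat n i ω = w
  · have hobs : (if E.obs n i ω ≤ y then (1 : ℝ) else 0) = outcomeInd w y (E.unit n i ω) :=
      if_congr (by rw [obs, unit, h]) rfl rfl
    rw [if_pos h, one_mul, hobs, ipWeight, if_pos h, piHat_design, div_eq_inv_mul]
    rfl
  · simp only [h, ipWeight, if_false, zero_mul, zero_div]

lemma cdfAIPW_eq_armScore [∀ s, IsProbabilityMeasure (stratumLaw Q s)] {w : Fin K} (y : ℝ)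
    (hw : ∀ s, (E.design n ω).piHat w s ≠ 0) (hm : BddMeasurable (Function.uncurry m)) :
    E.cdfAIPW m n w y ω
      = (∑ i, (armScore Q w y m (E.design n ω).piHat (E.treat n i ω) (E.unit n i ω)
          + popCDF (stratumLaw Q (E.strat n i ω)) w y)) / n := by
  rw [cdfAIPW_eq_ipWeight]
  congr 1
  have hmean := E.sum_ipWeight_mul hw fun s => stratumMean Q (residual w y m) s
  rw [← sub_eq_zero, ← Finset.sum_sub_distrib] at hmean ⊢
  refine (Finset.sum_congr rfl fun i _ => ?_).trans hmean
  have hres := stratumMean_residual w y (E.strat n i ω) hm (Q := Q)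
  simp only [armScore, centered, unit] at hres ⊢
  rw [hres]
  ring

lemma sqrt_mul_sub_eq_scoreSum [∀ s, IsProbabilityMeasure (stratumLaw Q s)] {w w' : Fin K} (y : ℝ)
    (hn : n ≠ 0) (hw : ∀ w s, (E.design n ω).piHat w s ≠ 0)
    (hm : BddMeasurable (Function.uncurry m)) (hm' : BddMeasurable (Function.uncurry m')) :
    √n * (E.cdfAIPW m n w y ω - E.cdfAIPW m' n w' y ω - dte Q w w' y)
      = E.scoreSum (dteScore Q w w' y m m')
          (fun s => dte (stratumLaw Q s) w w' y - dte Q w w' y) n ω := by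
  have hn' : (0 : ℝ) < n := mod_cast hn.pos
  rw [E.cdfAIPW_eq_armScore y (hw w) hm (Q := Q), E.cdfAIPW_eq_armScore y (hw w') hm' (Q := Q),
    scoreSum, eq_div_iff (Real.sqrt_pos.2 hn').ne', mul_right_comm, Real.mul_self_sqrt hn'.le,
    mul_sub, mul_sub, mul_div_cancel₀ _ hn'.ne', mul_div_cancel₀ _ hn'.ne']
  have hconst : (n : ℝ) * dte Q w w' y = ∑ _i : Fin n, dte Q w w' y := by simp
  rw [hconst, ← Finset.sum_sub_distrib, ← Finset.sum_sub_distrib]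
  exact Finset.sum_congr rfl fun i _ => by simp only [dteScore, dte]; ring

end Experiment

lemma Experiment.IsCAR.measurable_cdfAIPW [MeasurableSpace Ω] {P : Measure Ω}
    {Q : Measure (UnitData K M d)} {E : Experiment Ω K M d} {π : Fin K → Fin M → ℝ}
    (hE : E.IsCAR P Q π) {m : Fin M → (Fin d → ℝ) → ℝ} (hm : BddMeasurable (Function.uncurry m))
    (n : ℕ) (w : Fin K) (y : ℝ) : Measurable (E.cdfAIPW m n w y) := by
  have heq : E.cdfAIPW m n w y = _ := funext fun ω => E.cdfAIPW_eq_ipWeight m w y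
  rw [heq]
  refine Measurable.div_const
    (Finset.measurable_fun_sum _ fun i _ => Measurable.add (Measurable.mul ?_ ?_) ?_) _
  · exact (measurable_of_finite fun D : Design K M n => ipWeight D.piHat w (D.2 i) (D.1 i)).comp
      (hE.measurable_design n)
  · exact (bddMeasurable_residual w y hm).measurable.comp (hE.measurable_unit n i)
  · exact (hm.comp measurable_snd).measurable.comp (hE.measurable_unit n i)

theorem Experiment.IsCAR.hasAsymptoticVariance_cdfAIPW_sub [MeasurableSpace Ω] {P : Measure Ω}
    [IsProbabilityMeasure P] {Q : Measure (UnitData K M d)} [IsProbabilityMeasure Q]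
    {E : Experiment Ω K M d} {π : Fin K → Fin M → ℝ} (hE : E.IsCAR P Q π)
    {m m' : Fin M → (Fin d → ℝ) → ℝ} (hm : BddMeasurable (Function.uncurry m))
    (hm' : BddMeasurable (Function.uncurry m')) (w w' : Fin K) (y : ℝ) :
    HasAsymptoticVariance P (fun n ω => E.cdfAIPW m n w y ω - E.cdfAIPW m' n w' y ω)
      (dte Q w w' y) (scoreVariance Q π (dteScore Q w w' y m m')
        fun s => dte (stratumLaw Q s) w w' y - dte Q w w' y).toNNReal := by
  have := hE.isProbabilityMeasure_stratumLaw
  have hπ (w : Fin K) (s : Fin M) : π w s ≠ 0 := (hE.target_mem w s).1.ne'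
  have hclt := hE.tendstoInDistribution_scoreSum
    (ζ := fun s => dte (stratumLaw Q s) w w' y - dte Q w w' y)
    (isRegularScore_dteScore hπ w w' y hm hm') (integral_dte_stratumLaw w w' y)
  refine tendstoInDistribution_of_tendstoInMeasure_sub _ _ hclt ?_ fun n => ?_
  · refine tendstoInMeasure_const_iff_tendsto_whp.2 (tendsto_const_nhds.congr' ?_)
    have hpos : ∀ᶠ x : ℕ × Ω in whp P atTop, ∀ w s, (E.design x.1 x.2).piHat w s ≠ 0 := by
      simp only [eventually_all]
      exact fun w s =>
        (tendsto_pi_nhds.1 (tendsto_pi_nhds.1 hE.tendsto_piHat_whp w) s).eventually_ne (hπ w s)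
    filter_upwards [hpos, tendsto_fst_whp.eventually (eventually_ne_atTop 0)] with x hx hn
    exact (sub_eq_zero.2 (E.sqrt_mul_sub_eq_scoreSum y hn hx hm hm')).symm
  · exact (((hE.measurable_cdfAIPW hm n w y).sub (hE.measurable_cdfAIPW hm' n w' y)).sub_const
      _).const_mul _ |>.aemeasurable

/-! ### Optimality of the conditional distribution functions -/

namespace Experiment.IsCAR

lemma sum_target_eq_one [MeasurableSpace Ω] {P : Measure Ω} [IsProbabilityMeasure P]
    {Q : Measure (UnitData K M d)} [IsFiniteMeasure Q] {E : Experiment Ω K M d}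
    {π : Fin K → Fin M → ℝ} (hE : E.IsCAR P Q π) (s : Fin M) : ∑ v, π v s = 1 := by
  have hp : 0 < Q.real {u : UnitData K M d | u.2.1 = s} :=
    ENNReal.toReal_pos (hE.strat_pos s).ne' (measure_ne_top _ _)
  have hlim := tendsto_finsetSum Finset.univ fun v _ =>
    tendsto_pi_nhds.1 (tendsto_pi_nhds.1 hE.tendsto_piHat_whp v) s
  refine tendsto_nhds_unique hlim (tendsto_const_nhds.congr' ?_)
  filter_upwards [(hE.tendsto_nStrat_div s).eventually_ne hp.ne'] with x hx
  have hcard : E.nStrat x.1 s x.2 = ∑ v, E.nTreat x.1 v s x.2 := by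
    rw [Experiment.nStrat, Finset.card_eq_sum_card_fiberwise (f := fun i => E.treat x.1 i x.2)
      (t := Finset.univ) fun _ _ => Finset.mem_coe.2 (Finset.mem_univ _)]
    simp only [Experiment.nTreat, Finset.filter_filter, and_comm]
  simp only [piHat_design, Experiment.piHat]
  rw [← Finset.sum_div, ← Nat.cast_sum, ← hcard, div_self (left_ne_zero_of_mul hx)]

end Experiment.IsCAR

section condCDF

variable {Q : Measure (UnitData K M d)} [IsFiniteMeasure Q]

lemma bddMeasurable_condCDF (w : Fin K) (y : ℝ) :
    BddMeasurable (Function.uncurry (condCDF Q w y)) :=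
  ⟨(Kernel.measurable_coe _ measurableSet_Iic).ennreal_toReal, 1, fun z => by
    rw [Function.uncurry, condCDF, abs_of_nonneg measureReal_nonneg]
    exact measureReal_le_one⟩

lemma integral_mul_residual_condCDF (w : Fin K) (y : ℝ) {ψ : Fin M × (Fin d → ℝ) → ℝ}
    (hψ : BddMeasurable ψ) : ∫ u, ψ u.2 * residual w y (condCDF Q w y) u ∂Q = 0 := by
  have hX : Measurable fun u : UnitData K M d => u.2 := measurable_snd
  have hψX := hψ.comp hX
  have hout := bddMeasurable_outcomeInd (M := M) (d := d) w y
  have hcdf := condDistrib_ae_eq_condExp (μ := Q) hX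
    (show Measurable fun u : UnitData K M d => u.1 w by fun_prop) (measurableSet_Iic (a := y))
  have hpull := condExp_mul_of_stronglyMeasurable_left
    (hψ.measurable.comp (comap_measurable fun u : UnitData K M d => u.2)).stronglyMeasurable
    ((hψX.mul hout).integrable Q) (hout.integrable Q)
  have hμ : BddMeasurable fun u : UnitData K M d => condCDF Q w y u.2.1 u.2.2 :=
    (bddMeasurable_condCDF w y).comp hX
  have htower : ∫ u, ψ u.2 * outcomeInd w y u ∂Q
      = ∫ u, ψ u.2 * condCDF Q w y u.2.1 u.2.2 ∂Q := by
    rw [← integral_condExp hX.comap_le]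
    refine integral_congr_ae (hpull.trans ?_)
    filter_upwards [hcdf] with u hu
    exact congrArg (ψ u.2 * ·) hu.symm
  simp only [residual, mul_sub]
  rw [integral_sub ((hψX.mul hout).integrable Q) ((hψX.mul hμ).integrable Q), htower, sub_self]

lemma stratumMean_residual_condCDF (w : Fin K) (y : ℝ) (s : Fin M) :
    stratumMean Q (residual w y (condCDF Q w y)) s = 0 := by
  have hs : MeasurableSet ((fun u : UnitData K M d => u.2.1) ⁻¹' {s}) :=
    (measurable_fst.comp measurable_snd) (measurableSet_singleton s)
  have hψ : BddMeasurable fun z : Fin M × (Fin d → ℝ) => if z.1 = s then (1 : ℝ) else 0 :=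
    (BddMeasurable.of_finite fun r : Fin M => if r = s then (1 : ℝ) else 0).comp measurable_fst
  have hset : ∫ u in (fun u : UnitData K M d => u.2.1) ⁻¹' {s},
      residual w y (condCDF Q w y) u ∂Q = 0 := by
    rw [← integral_mul_residual_condCDF (Q := Q) w y hψ, ← integral_indicator hs]
    refine integral_congr_ae (ae_of_all _ fun u => ?_)
    by_cases hu : u.2.1 = s <;> simp [hu]
  rw [stratumMean, stratumLaw, ProbabilityTheory.cond, integral_smul_measure, hset, smul_zero]

/-- The error `μ_w(y, s, x) - m(s, x)` of the adjustment term `m`, centered within strata. -/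
def adjError (Q : Measure (UnitData K M d)) [IsFiniteMeasure Q] (w : Fin K) (y : ℝ)
    (m : Fin M → (Fin d → ℝ) → ℝ) (z : Fin M × (Fin d → ℝ)) : ℝ :=
  condCDF Q w y z.1 z.2 - m z.1 z.2
    - stratumMean Q (fun u => condCDF Q w y u.2.1 u.2.2 - m u.2.1 u.2.2) z.1

/-- The amount by which `dteScore` changes when the conditional distribution functions are replaced
by the adjustment terms `m` and `m'`; it depends on the unit through `(S, X)` only. -/
def dteScoreGap (Q : Measure (UnitData K M d)) [IsFiniteMeasure Q] (w w' : Fin K) (y : ℝ)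
    (m m' : Fin M → (Fin d → ℝ) → ℝ) (c : Fin K → Fin M → ℝ) (v : Fin K)
    (z : Fin M × (Fin d → ℝ)) : ℝ :=
  (ipWeight c w v z.1 - 1) * adjError Q w y m z
    - (ipWeight c w' v z.1 - 1) * adjError Q w' y m' z

variable {m m' : Fin M → (Fin d → ℝ) → ℝ} {c : Fin K → Fin M → ℝ}

lemma bddMeasurable_adjError (w : Fin K) (y : ℝ) (hm : BddMeasurable (Function.uncurry m)) :
    BddMeasurable (adjError Q w y m) :=
  ((bddMeasurable_condCDF w y).sub hm).sub ((BddMeasurable.of_finite _).comp measurable_fst)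

lemma bddMeasurable_dteScoreGap (w w' : Fin K) (y : ℝ) (hm : BddMeasurable (Function.uncurry m))
    (hm' : BddMeasurable (Function.uncurry m')) (c : Fin K → Fin M → ℝ) (v : Fin K) :
    BddMeasurable (dteScoreGap Q w w' y m m' c v) := by
  have hweight (w : Fin K) : BddMeasurable fun z : Fin M × (Fin d → ℝ) => ipWeight c w v z.1 - 1 :=
    (BddMeasurable.of_finite fun s => ipWeight c w v s - 1).comp measurable_fst
  exact ((hweight w).mul (bddMeasurable_adjError w y hm)).sub
    ((hweight w').mul (bddMeasurable_adjError w' y hm'))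

lemma sum_mul_ipWeight_mul {w : Fin K} {s : Fin M} (hw : c w s ≠ 0) (F : Fin K → ℝ) :
    ∑ v, c v s * (ipWeight c w v s * F v) = F w := by
  simp [ipWeight, hw]

lemma sum_mul_dteScoreGap {w w' : Fin K} (y : ℝ) {z : Fin M × (Fin d → ℝ)}
    (hw : c w z.1 ≠ 0) (hw' : c w' z.1 ≠ 0) (hc : ∑ v, c v z.1 = 1) :
    ∑ v, c v z.1 * dteScoreGap Q w w' y m m' c v z = 0 := by
  have hweight {w : Fin K} (hw : c w z.1 ≠ 0) : ∑ v, c v z.1 * (ipWeight c w v z.1 - 1) = 0 := by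
    simpa [mul_sub, hc] using sub_eq_zero.2 (sum_mul_ipWeight_mul hw fun _ => 1)
  simp only [dteScoreGap, mul_sub (c _ _) (_ * _), ← mul_assoc, Finset.sum_sub_distrib,
    ← Finset.sum_mul, hweight hw, hweight hw', zero_mul, sub_self]

lemma sum_mul_dteScore_mul_dteScoreGap {w w' : Fin K} (y : ℝ) {u : UnitData K M d}
    (hw : c w u.2.1 ≠ 0) (hw' : c w' u.2.1 ≠ 0) (hc : ∑ v, c v u.2.1 = 1) :
    ∑ v, c v u.2.1 * (dteScore Q w w' y (condCDF Q w y) (condCDF Q w' y) c v u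
        * dteScoreGap Q w w' y m m' c v u.2)
      = dteScoreGap Q w w' y m m' c w u.2 * residual w y (condCDF Q w y) u
        - dteScoreGap Q w w' y m m' c w' u.2 * residual w' y (condCDF Q w' y) u := by
  set gap := fun v => dteScoreGap Q w w' y m m' c v u.2
  set b := centered Q (fun u => condCDF Q w y u.2.1 u.2.2) u
    - centered Q (fun u => condCDF Q w' y u.2.1 u.2.2) u with hb
  have hgap : ∑ v, c v u.2.1 * gap v = 0 := sum_mul_dteScoreGap y hw hw' hc
  have hscore (v : Fin K) : dteScore Q w w' y (condCDF Q w y) (condCDF Q w' y) c v u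
      = ipWeight c w v u.2.1 * residual w y (condCDF Q w y) u
        - ipWeight c w' v u.2.1 * residual w' y (condCDF Q w' y) u + b := by
    have hres (w : Fin K) : centered Q (residual w y (condCDF Q w y)) u
        = residual w y (condCDF Q w y) u := by
      rw [centered, stratumMean_residual_condCDF, sub_zero]
    rw [dteScore, armScore, armScore, hres, hres, hb]
    ring
  calc _ = ∑ v, c v u.2.1 * (ipWeight c w v u.2.1 * gap v) * residual w y (condCDF Q w y) u
        - ∑ v, c v u.2.1 * (ipWeight c w' v u.2.1 * gap v) * residual w' y (condCDF Q w' y) u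
        + b * ∑ v, c v u.2.1 * gap v := by
          rw [Finset.mul_sum, ← Finset.sum_sub_distrib, ← Finset.sum_add_distrib]
          exact Finset.sum_congr rfl fun v _ => by rw [hscore]; ring
    _ = _ := by
          rw [← Finset.sum_mul, ← Finset.sum_mul, sum_mul_ipWeight_mul hw gap,
            sum_mul_ipWeight_mul hw' gap, hgap, mul_zero, add_zero]

lemma armScore_eq_add_adjError [∀ s, IsProbabilityMeasure (stratumLaw Q s)] (w : Fin K) (y : ℝ)
    (hm : BddMeasurable (Function.uncurry m)) (c : Fin K → Fin M → ℝ) (v : Fin K)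
    (u : UnitData K M d) :
    armScore Q w y m c v u = armScore Q w y (condCDF Q w y) c v u
      + (ipWeight c w v u.2.1 - 1) * adjError Q w y m u.2 := by
  have hμ := bddMeasurable_condCDF (Q := Q) w y
  have hmean : stratumMean Q (fun u => condCDF Q w y u.2.1 u.2.2 - m u.2.1 u.2.2) u.2.1
      = stratumMean Q (fun u => condCDF Q w y u.2.1 u.2.2) u.2.1
        - stratumMean Q (fun u => m u.2.1 u.2.2) u.2.1 :=
    integral_sub ((hμ.comp measurable_snd).integrable _) ((hm.comp measurable_snd).integrable _)
  simp only [armScore, adjError, centered, stratumMean_residual w y u.2.1 hm,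
    stratumMean_residual w y u.2.1 hμ, hmean, residual]
  ring

lemma dteScore_eq_add_dteScoreGap [∀ s, IsProbabilityMeasure (stratumLaw Q s)] (w w' : Fin K)
    (y : ℝ) (hm : BddMeasurable (Function.uncurry m)) (hm' : BddMeasurable (Function.uncurry m'))
    (c : Fin K → Fin M → ℝ) (v : Fin K) (u : UnitData K M d) :
    dteScore Q w w' y m m' c v u = dteScore Q w w' y (condCDF Q w y) (condCDF Q w' y) c v u
      + dteScoreGap Q w w' y m m' c v u.2 := by
  rw [dteScore, armScore_eq_add_adjError w y hm, armScore_eq_add_adjError w' y hm', dteScore,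
    dteScoreGap]
  ring

end condCDF

section scoreVariance

variable {Q : Measure (UnitData K M d)} [IsFiniteMeasure Q] {π : Fin K → Fin M → ℝ}

lemma scoreVariance_le_add {f g : (Fin K → Fin M → ℝ) → Fin K → UnitData K M d → ℝ}
    (hπ : ∀ v s, 0 ≤ π v s) (hf : ∀ v, BddMeasurable (f π v)) (hg : ∀ v, BddMeasurable (g π v))
    (horth : ∫ u, ∑ v, π v u.2.1 * (f π v u * g π v u) ∂Q = 0) (ζ : Fin M → ℝ) :
    scoreVariance Q π f ζ ≤ scoreVariance Q π (fun c v u => f c v u + g c v u) ζ := by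
  have hsum {h : Fin K → UnitData K M d → ℝ} (hh : ∀ v, BddMeasurable (h v)) :
      BddMeasurable fun u => ∑ v, π v u.2.1 * h v u :=
    BddMeasurable.sum fun v _ => (bddMeasurable_comp_strat (π v)).mul (hh v)
  have hff := ((hsum fun v => (hf v).pow 2).add ((bddMeasurable_comp_strat ζ).pow 2)).integrable Q
  have hfg := (hsum fun v => (hf v).mul (hg v)).integrable Q
  have hgg := (hsum fun v => (hg v).pow 2).integrable Q
  have hexpand : scoreVariance Q π (fun c v u => f c v u + g c v u) ζ
      = scoreVariance Q π f ζ + 2 * ∫ u, ∑ v, π v u.2.1 * (f π v u * g π v u) ∂Q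
        + ∫ u, ∑ v, π v u.2.1 * g π v u ^ 2 ∂Q := by
    rw [scoreVariance, scoreVariance, ← integral_const_mul, ← integral_add hff (hfg.const_mul 2),
      ← integral_add (hff.fun_add (hfg.const_mul 2)) hgg]
    refine integral_congr_ae (ae_of_all _ fun u => ?_)
    simp only [Finset.mul_sum, add_right_comm _ (ζ _ ^ 2), ← Finset.sum_add_distrib]
    congr 1
    exact Finset.sum_congr rfl fun v _ => by ring
  rw [hexpand, horth, mul_zero, add_zero]
  exact le_add_of_nonneg_right <| integral_nonneg fun u =>
    Finset.sum_nonneg fun v _ => mul_nonneg (hπ v _) (sq_nonneg _)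

lemma scoreVariance_dteScore_condCDF_le [∀ s, IsProbabilityMeasure (stratumLaw Q s)]
    {m m' : Fin M → (Fin d → ℝ) → ℝ} (hπ : ∀ v s, 0 < π v s) (hπ1 : ∀ s, ∑ v, π v s = 1)
    (w w' : Fin K) (y : ℝ) (hm : BddMeasurable (Function.uncurry m))
    (hm' : BddMeasurable (Function.uncurry m')) (ζ : Fin M → ℝ) :
    scoreVariance Q π (dteScore Q w w' y (condCDF Q w y) (condCDF Q w' y)) ζ
      ≤ scoreVariance Q π (dteScore Q w w' y m m') ζ := by
  have hgap := bddMeasurable_dteScoreGap (Q := Q) w w' y hm hm' π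
  have hreg := isRegularScore_dteScore (Q := Q) (fun v s => (hπ v s).ne') w w' y
    (bddMeasurable_condCDF (Q := Q) w y) (bddMeasurable_condCDF (Q := Q) w' y)
  have horth (v : Fin K) (x : Fin K) := integral_mul_residual_condCDF (Q := Q) x y (hgap v)
  have hint (v x : Fin K) := (((hgap v).comp measurable_snd).mul
    (bddMeasurable_residual x y (bddMeasurable_condCDF (Q := Q) x y))).integrable Q
  simp only [funext fun c => funext fun v => funext fun u =>
    dteScore_eq_add_dteScoreGap (Q := Q) w w' y hm hm' c v u]
  refine scoreVariance_le_add (fun v s => (hπ v s).le) (hreg.bddMeasurable π)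
    (fun v => (hgap v).comp measurable_snd) ?_ ζ
  simp only [sum_mul_dteScore_mul_dteScoreGap y (hπ w _).ne' (hπ w' _).ne' (hπ1 _)]
  rw [integral_sub (hint w w) (hint w' w'), horth, horth, sub_self]

end scoreVariance

end

end CAR

theorem corollary1_general {Ω : Type*} [MeasurableSpace Ω] (P : Measure Ω) [IsProbabilityMeasure P]
    {K M d : ℕ} (E : CAR.Experiment Ω K M d)
    (Q : Measure (CAR.UnitData K M d)) [IsProbabilityMeasure Q]
    (π : Fin K → Fin M → ℝ) (hE : E.IsCAR P Q π) (w w' : Fin K) (y : ℝ) :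
    ∃ Vadj : ℝ≥0, CAR.HasAsymptoticVariance P (E.dteAdj Q w w' y) (CAR.dte Q w w' y) Vadj ∧
      ∀ m m' : Fin M → (Fin d → ℝ) → ℝ, CAR.BddMeasurable (Function.uncurry m) →
        CAR.BddMeasurable (Function.uncurry m') → ∃ V : ℝ≥0,
          CAR.HasAsymptoticVariance P (fun n ω => E.cdfAIPW m n w y ω - E.cdfAIPW m' n w' y ω)
            (CAR.dte Q w w' y) V ∧
          Vadj ≤ V := by
  have := hE.isProbabilityMeasure_stratumLaw
  have hμ (v : Fin K) := CAR.bddMeasurable_condCDF (Q := Q) v y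
  refine ⟨_, hE.hasAsymptoticVariance_cdfAIPW_sub (hμ w) (hμ w') w w' y, fun m m' hm hm' =>
    ⟨_, hE.hasAsymptoticVariance_cdfAIPW_sub hm hm' w w' y, Real.toNNReal_le_toNNReal ?_⟩⟩
  exact CAR.scoreVariance_dteScore_condCDF_le (fun v s => (hE.target_mem v s).1)
    hE.sum_target_eq_one w w' y hm hm' _

theorem corollary1 {Ω : Type*} [MeasurableSpace Ω] (P : Measure Ω) [IsProbabilityMeasure P]
    {K M d : ℕ} (E : CAR.Experiment Ω K M d)
    (Q : Measure (CAR.UnitData K M d)) [IsProbabilityMeasure Q]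
    (π : Fin K → Fin M → ℝ) (hE : E.IsCAR P Q π) (w w' : Fin K) (y : ℝ) :
    ∃ Vadj Vemp : ℝ≥0,
      CAR.HasAsymptoticVariance P (E.dteAdj Q w w' y) (CAR.dte Q w w' y) Vadj ∧
      CAR.HasAsymptoticVariance P (E.dteEmp w w' y) (CAR.dte Q w w' y) Vemp ∧
      Vadj ≤ Vemp := by
  obtain ⟨Vadj, hadj, hopt⟩ := corollary1_general P E Q π hE w w' y
  obtain ⟨Vemp, hemp, hle⟩ := hopt 0 0 (CAR.BddMeasurable.const 0) (CAR.BddMeasurable.const 0)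
  exact ⟨Vadj, Vemp, hadj, E.dteEmp_eq_cdfAIPW_zero_sub w w' y ▸ hemp, hle⟩
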